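/- **Setting.** Let $\Bbbk$ be an algebraically closed field. A *finite category* is a $\Bbbk$-linear abelian category with finite-dimensional morphism spaces, all objects of finite length, enough projectives and finitely many simple objects up to isomorphism; a *tensor category* is a finite category that is rigid monoidal with $\Bbbk$-bilinear tensor product and simple unit. Let $\mathcal V$ be a braided tensor category, $\mathcal C$ a tensor category, and $G:\mathcal V\to\mathcal Z(\mathcal C)$ a $\Bbbk$-linear, right exact, faithful, braided monoidal functor; write $\sigma_{G(V),X}:G(V)\otimes X\to X\otimes G(V)$ for the half-braiding of $G(V)$. Let $\mathcal M$ be a $\mathcal C$-module category, that is a finite category with an associative and unital $\Bbbk$-bilinear action $\triangleright:\mathcal C\times\mathcal M\to\mathcal M$ that is exact in each variable; it is a $\mathcal V$-module category by $V\triangleright M=G(V)\triangleright M$. *The categories.* $\mathcal C^*_{\mathcal M}$ is the category of $\Bbbk$-linear $\mathcal C$-module functors $(F,c)$, $c_{X,M}:F(X\triangleright M)\cong X\triangleright F(M)$, and natural module transformations; $\operatorname{End}_{\mathcal V}(\mathcal M)$ is the category of $\Bbbk$-linear $\mathcal V$-module functors $(F,d):\mathcal M\to\mathcal M$ and natural module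 transformations. The latter is a $\mathcal C$-bimodule category by $(X\triangleright F)(M)=X\triangleright F(M)$, $(F\triangleleft X)(M)=F(X\triangleright M)$, with $\mathcal V$-module structures obtained from $d$ and $\sigma_{G(V),X}^{-1}$. For a $\mathcal C$-bimodule category $\mathcal N$, $\mathcal Z_{\mathcal C}(\mathcal N)$ is the category of objects $N\in\mathcal N$ with a half-braiding $N\triangleleft X\cong X\triangleright N$; thus $\mathcal Z_{\mathcal C}(\mathcal C)=\mathcal Z(\mathcal C)$, and objects of $\mathcal Z_{\mathcal C}(\operatorname{End}_{\mathcal V}(\mathcal M))$ are triples $(F,c,d)$ with $(F,d)\in\operatorname{End}_{\mathcal V}(\mathcal M)$ and $c$ a half-braiding, with components $c_{X,M}:F(X\triangleright M)\cong X\triangleright F(M)$. Let $\mathcal C(\mathcal V,\mathcal M)\subseteq\mathcal Z_{\mathcal C}(\operatorname{End}_{\mathcal V}(\mathcal M))$ be the full subcategory of those $(F,c,d)$ with $c|_{\mathcal V}=d$, i.e. $c_{G(V),M}=d_{V,M}$ for all $V\in\mathcal V$, $M\in\mathcal M$. The relative center $\mathcal Z^{\mathcal V}(\mathcal C)\subseteq\mathcal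 Z(\mathcal C)$ is the full subcategory of the objects $(A,\sigma_{A,-})$ with $\sigma_{G(V),A}\,\sigma_{A,G(V)}=\mathrm{id}_{A\otimes G(V)}$ for all $V\in\mathcal V$. *The functor $\bar\rho$.* Let $\underline{\mathrm{Hom}}(M,N)\in\mathcal C$ denote internal Homs, objects representing $\mathrm{Hom}_{\mathcal M}(-\triangleright M,N)$. For $(F,d)\in\operatorname{End}_{\mathcal V}(\mathcal M)$ let $\beta^V_{M,N}:\underline{\mathrm{Hom}}(M,F(V\triangleright N))\to\underline{\mathrm{Hom}}(V^*\triangleright M,F(N))$ be the morphism that corresponds, under the representing bijections, to sending $f:X\triangleright M\to F(V\triangleright N)$ to $(\mathrm{ev}_V\triangleright F(N))\,(V^*\triangleright d_{V,N}f)\,(\sigma_{G(V^*),X}^{-1}\triangleright M): X\triangleright(V^*\triangleright M)\to F(N)$. The relative end $\bar\rho(F,d)=\oint_{M\in\mathcal M}(\underline{\mathrm{Hom}}(M,F(M)),\beta)$ is the object of $\mathcal C$ that is universal among objects $E$ with dinatural morphisms $\pi_M:E\to\underline{\mathrm{Hom}}(M,F(M))$ satisfying $\underline{\mathrm{Hom}}(\mathrm{ev}_V\triangleright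 M,F(M))\,\pi_M=\beta^V_{V\triangleright M,M}\,\pi_{V\triangleright M}$ for all $V,M$ (associativity isomorphisms suppressed). Then $\bar\rho:\operatorname{End}_{\mathcal V}(\mathcal M)\to\mathcal C$ is a right adjoint of the bimodule functor $\rho:\mathcal C\to\operatorname{End}_{\mathcal V}(\mathcal M)$, $\rho(X)=X\triangleright-$ with $\mathcal V$-module structure $\sigma_{G(V),X}^{-1}\triangleright M$; hence it is a $\mathcal C$-bimodule functor and induces $\mathcal Z_{\mathcal C}(\bar\rho):\mathcal Z_{\mathcal C}(\operatorname{End}_{\mathcal V}(\mathcal M))\to\mathcal Z(\mathcal C)$. **Theorem.** All the internal Homs and relative ends above exist, and for every choice of them the following hold. 1. If $(F,c,d)\in\mathcal C(\mathcal V,\mathcal M)$, then $\mathcal Z_{\mathcal C}(\bar\rho)(F,c,d)$ has trivial double braiding with $G(V)$ for every $V\in\mathcal V$; that is, $\mathcal Z_{\mathcal C}(\bar\rho)(F,c,d)\in\mathcal Z^{\mathcal V}(\mathcal C)$. 2. Consequently there is a functor $\mathcal C(\mathcal V,\mathcal M)\to\mathcal Z^{\mathcal V}(\mathcal C)$ whose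 composite with the inclusion $\mathcal Z^{\mathcal V}(\mathcal C)\hookrightarrow\mathcal Z(\mathcal C)$ equals the restriction of $\mathcal Z_{\mathcal C}(\bar\rho)$ to $\mathcal C(\mathcal V,\mathcal M)$. 3. The functor $\mathcal C^*_{\mathcal M}\to\mathcal C(\mathcal V,\mathcal M)$, $(F,c)\mapsto(F,c,c|_{\mathcal V})$ with $(c|_{\mathcal V})_{V,M}=c_{G(V),M}$, is an equivalence of categories; and there is a functor $\Psi:\mathcal C^*_{\mathcal M}\to\mathcal Z^{\mathcal V}(\mathcal C)$ whose composite with the inclusion into $\mathcal Z(\mathcal C)$ equals the composite $\mathcal C^*_{\mathcal M}\to\mathcal C(\mathcal V,\mathcal M)\hookrightarrow\mathcal Z_{\mathcal C}(\operatorname{End}_{\mathcal V}(\mathcal M))\to\mathcal Z(\mathcal C)$, the last functor being $\mathcal Z_{\mathcal C}(\bar\rho)$. -/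

import Mathlib

open CategoryTheory MonoidalCategory Limits Opposite
open scoped MonoidalLeftAction MonoidalRightAction

noncomputable section

namespace CentralHopf

universe w v₁ v₂ v₃ u₁ u₂ u₃

/-! ### Coherence for actions of monoidal categories -/

section Coherence

open MonoidalLeftAction

variable {C : Type u₂} [Category.{v₂} C] [MonoidalCategory C]
  {M : Type u₃} [Category.{v₃} M] [MonoidalLeftAction C M]

lemma assoc_hom_act (X A B : C) (m : M) : (α_ X A B).hom ⊵ₗ m =
    (αₗ (X ⊗ A) B m).hom ≫ (αₗ X A (B ⊙ₗ m)).hom ≫ X ⊴ₗ (αₗ A B m).inv ≫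
      (αₗ X (A ⊗ B) m).inv := by
  have h := associator_actionHom X A B m
  rw [← reassoc_of% h]
  simp

lemma assoc_inv_act (X A B : C) (m : M) : (α_ X A B).inv ⊵ₗ m =
    (αₗ X (A ⊗ B) m).hom ≫ X ⊴ₗ (αₗ A B m).hom ≫ (αₗ X A (B ⊙ₗ m)).inv ≫
      (αₗ (X ⊗ A) B m).inv := by
  rw [← cancel_epi ((α_ X A B).hom ⊵ₗ m), ← comp_actionHomLeft, assoc_hom_act]
  simp

lemma leftUnitor_inv_act (X : C) (m : M) : (λ_ X).inv ⊵ₗ m =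
    (λₗ (X ⊙ₗ m)).inv ≫ (αₗ (𝟙_ C) X m).inv := by
  rw [← cancel_epi ((λ_ X).hom ⊵ₗ m), ← comp_actionHomLeft, leftUnitor_actionHom]
  simp

lemma rightUnitor_inv_act (X : C) (m : M) : (ρ_ X).inv ⊵ₗ m =
    X ⊴ₗ (λₗ m).inv ≫ (αₗ X (𝟙_ C) m).inv := by
  rw [← cancel_epi ((ρ_ X).hom ⊵ₗ m), ← comp_actionHomLeft, rightUnitor_actionHom]
  simp

/-- The morphism `X ▷ (A ▷ m) ⟶ A ▷ (X ▷ m)` induced by `s : X ⊗ A ⟶ A ⊗ X`. -/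
def actSwap {X A : C} (s : X ⊗ A ⟶ A ⊗ X) (m : M) : X ⊙ₗ A ⊙ₗ m ⟶ A ⊙ₗ X ⊙ₗ m :=
  (αₗ X A m).inv ≫ s ⊵ₗ m ≫ (αₗ A X m).hom

lemma actSwap_assoc {X A B D : C} (e : D ⟶ A ⊗ B) (a : X ⊗ A ⟶ A ⊗ X) (b : X ⊗ B ⟶ B ⊗ X)
    (c : X ⊗ D ⟶ D ⊗ X) (h : c ≫ e ▷ X = X ◁ e ≫ (α_ X A B).inv ≫ a ▷ B ≫ (α_ A X B).hom ≫
      A ◁ b ≫ (α_ A B X).inv) (m : M) :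
    actSwap c m ≫ e ⊵ₗ (X ⊙ₗ m) ≫ (αₗ A B (X ⊙ₗ m)).hom =
      X ⊴ₗ (e ⊵ₗ m ≫ (αₗ A B m).hom) ≫ actSwap a (B ⊙ₗ m) ≫ A ⊴ₗ actSwap b m := by
  have h' := congrArg (· ⊵ₗ m) h
  simp only [comp_actionHomLeft, whiskerLeft_actionHomLeft, Category.assoc] at h'
  rw [← cancel_epi (αₗ X D m).hom]
  simp [actSwap, reassoc_of% h', assoc_hom_act, assoc_inv_act]

lemma actSwap_unit {X D : C} (e : D ⟶ 𝟙_ C) (c : X ⊗ D ⟶ D ⊗ X)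
    (h : c ≫ e ▷ X = X ◁ e ≫ (ρ_ X).hom ≫ (λ_ X).inv) (m : M) :
    actSwap c m ≫ e ⊵ₗ (X ⊙ₗ m) ≫ (λₗ (X ⊙ₗ m)).hom = X ⊴ₗ (e ⊵ₗ m ≫ (λₗ m).hom) := by
  have h' := congrArg (· ⊵ₗ m) h
  simp only [comp_actionHomLeft, whiskerLeft_actionHomLeft, Category.assoc] at h'
  rw [← cancel_epi (αₗ X D m).hom]
  simp [actSwap, reassoc_of% h', leftUnitor_inv_act]

lemma actSwap_tensor {X Y A : C} (a : X ⊗ A ⟶ A ⊗ X) (b : Y ⊗ A ⟶ A ⊗ Y)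
    (c : (X ⊗ Y) ⊗ A ⟶ A ⊗ X ⊗ Y)
    (h : c = (α_ X Y A).hom ≫ X ◁ b ≫ (α_ X A Y).inv ≫ a ▷ Y ≫ (α_ A X Y).hom) (m : M) :
    actSwap c m ≫ A ⊴ₗ (αₗ X Y m).hom =
      (αₗ X Y (A ⊙ₗ m)).hom ≫ X ⊴ₗ actSwap b m ≫ actSwap a (Y ⊙ₗ m) := by
  subst h
  simp [actSwap, assoc_hom_act, assoc_inv_act]

lemma actSwap_unit_left {A : C} (a : 𝟙_ C ⊗ A ⟶ A ⊗ 𝟙_ C) (h : a = (λ_ A).hom ≫ (ρ_ A).inv)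
    (m : M) : actSwap a m ≫ A ⊴ₗ (λₗ m).hom = (λₗ (A ⊙ₗ m)).hom := by
  subst h
  simp [actSwap, rightUnitor_inv_act]

lemma actSwap_nat {X A : C} (s : X ⊗ A ⟶ A ⊗ X) {m n : M} (f : m ⟶ n) :
    X ⊴ₗ A ⊴ₗ f ≫ actSwap s n = actSwap s m ≫ A ⊴ₗ X ⊴ₗ f := by
  have h := action_exchange s f
  simp only [tensor_actionHomRight, Category.assoc] at h
  rw [← cancel_epi (αₗ X A m).hom, ← cancel_mono (αₗ A X n).inv]
  simpa [actSwap] using h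

lemma actSwap_nat_left {X Y A : C} (s : X ⊗ A ⟶ A ⊗ X) (t : Y ⊗ A ⟶ A ⊗ Y) (f : X ⟶ Y)
    (h : s ≫ A ◁ f = f ▷ A ≫ t) (m : M) :
    f ⊵ₗ (A ⊙ₗ m) ≫ actSwap t m = actSwap s m ≫ A ⊴ₗ f ⊵ₗ m := by
  have h := congrArg (· ⊵ₗ m) h
  simp only [comp_actionHomLeft, whiskerLeft_actionHomLeft] at h
  rw [← cancel_epi (αₗ X A m).hom, ← cancel_mono (αₗ A Y m).inv]
  simpa [actSwap] using h.symm

lemma actSwap_nat_mid {X A B : C} (s : X ⊗ A ⟶ A ⊗ X) (t : X ⊗ B ⟶ B ⊗ X) (g : A ⟶ B)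
    (h : s ≫ g ▷ X = X ◁ g ≫ t) (m : M) :
    X ⊴ₗ g ⊵ₗ m ≫ actSwap t m = actSwap s m ≫ g ⊵ₗ (X ⊙ₗ m) := by
  have h := congrArg (· ⊵ₗ m) h
  simp only [comp_actionHomLeft, whiskerLeft_actionHomLeft] at h
  rw [← cancel_epi (αₗ X A m).hom, ← cancel_mono (αₗ B X m).inv]
  simpa [actSwap] using h.symm

end Coherence

/-! ### The action of `V` on a `C`-module category along a functor `V ⥤ Z(C)` -/

section VAction

variable {V : Type u₁} [Category.{v₁} V]
  {C : Type u₂} [Category.{v₂} C] [MonoidalCategory C]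

/-- The functor `V ⥤ C` underlying a functor `V ⥤ Z(C)`. -/
def und (G : V ⥤ Center C) : V ⥤ C := G ⋙ Center.forget C

/-- The half-braiding `σ_{G(U),X} : G(U) ⊗ X ≅ X ⊗ G(U)` of the object `G(U)` of the center. -/
def hb (G : V ⥤ Center C) (U : V) (X : C) : (und G).obj U ⊗ X ≅ X ⊗ (und G).obj U :=
  (G.obj U).2.β X

section

variable (G : V ⥤ Center C)

lemma hb_nat (U : V) {X Y : C} (f : X ⟶ Y) :
    (hb G U X).inv ≫ (und G).obj U ◁ f = f ▷ (und G).obj U ≫ (hb G U Y).inv := by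
  rw [Iso.inv_comp_eq, ← Category.assoc, Iso.eq_comp_inv]
  exact (G.obj U).2.naturality f

lemma hb_map {U W : V} (g : U ⟶ W) (X : C) :
    (hb G U X).inv ≫ (und G).map g ▷ X = X ◁ (und G).map g ≫ (hb G W X).inv := by
  rw [Iso.inv_comp_eq, ← Category.assoc, Iso.eq_comp_inv]
  exact (G.map g).comm X

lemma hb_tensor (U : V) (X Y : C) :
    (hb G U (X ⊗ Y)).hom = (α_ _ _ _).inv ≫ (hb G U X).hom ▷ Y ≫ (α_ _ _ _).hom ≫
      X ◁ (hb G U Y).hom ≫ (α_ _ _ _).inv :=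
  (G.obj U).2.monoidal X Y

lemma hb_tensor_inv (U : V) (X Y : C) :
    (hb G U (X ⊗ Y)).inv = (α_ _ _ _).hom ≫ X ◁ (hb G U Y).inv ≫ (α_ _ _ _).inv ≫
      (hb G U X).inv ▷ Y ≫ (α_ _ _ _).hom := by
  rw [← cancel_epi (hb G U (X ⊗ Y)).hom, Iso.hom_inv_id, hb_tensor]
  simp

lemma hb_unit (U : V) : (hb G U (𝟙_ C)).inv = (λ_ _).hom ≫ (ρ_ _).inv := by
  have h : (hb G U (𝟙_ C)).hom = (ρ_ _).hom ≫ (λ_ _).inv := by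
    have h := congrArg Center.Hom.f (braiding_tensorUnit_right (G.obj U))
    refine h.trans ?_
    refine (Center.comp_f _ _).trans ?_
    rw [Center.rightUnitor_hom_f, Center.leftUnitor_inv_f]
    rfl
  rw [← cancel_epi (hb G U (𝟙_ C)).hom, Iso.hom_inv_id, h]
  simp only [Category.assoc, Iso.inv_hom_id_assoc, Iso.hom_inv_id]

end

section

variable [MonoidalCategory V] (G : V ⥤ Center C) [G.Monoidal]

instance : (und G).Monoidal := inferInstanceAs (G ⋙ Center.forget C).Monoidal

lemma und_μ (U W : V) :
    Functor.LaxMonoidal.μ (und G) U W = (Functor.LaxMonoidal.μ G U W).f := by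
  change Functor.LaxMonoidal.μ (G ⋙ Center.forget C) U W = _
  rw [Functor.LaxMonoidal.comp_μ]
  exact Category.id_comp _

lemma und_ε :
    Functor.LaxMonoidal.ε (und G) = (Functor.LaxMonoidal.ε G).f := by
  change Functor.LaxMonoidal.ε (G ⋙ Center.forget C) = _
  rw [Functor.LaxMonoidal.comp_ε]
  exact Category.id_comp _

lemma hb_δ (U W : V) (X : C) :
    (hb G (U ⊗ W) X).inv ≫ Functor.OplaxMonoidal.δ (und G) U W ▷ X =
      X ◁ Functor.OplaxMonoidal.δ (und G) U W ≫ (α_ _ _ _).inv ≫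
        (hb G U X).inv ▷ (und G).obj W ≫ (α_ _ _ _).hom ≫
          (und G).obj U ◁ (hb G W X).inv ≫ (α_ _ _ _).inv := by
  have h : Functor.LaxMonoidal.μ (und G) U W ▷ X ≫ (hb G (U ⊗ W) X).hom =
      ((α_ _ _ _).hom ≫ (und G).obj U ◁ (hb G W X).hom ≫ (α_ _ _ _).inv ≫
        (hb G U X).hom ▷ (und G).obj W ≫ (α_ _ _ _).hom) ≫
          X ◁ Functor.LaxMonoidal.μ (und G) U W := by
    rw [und_μ]
    refine ((Functor.LaxMonoidal.μ G U W).comm X).trans ?_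
    have h := congrArg Iso.hom (Center.tensor_β (G.obj U) (G.obj W) X)
    exact congrArg (· ≫ X ◁ (Functor.LaxMonoidal.μ G U W).f) h
  have h2 := congrArg (fun t => (hb G (U ⊗ W) X).inv ≫
    Functor.OplaxMonoidal.δ (und G) U W ▷ X ≫ t ≫ X ◁ Functor.OplaxMonoidal.δ (und G) U W) h
  simp only [Category.assoc, Functor.Monoidal.whiskerLeft_μ_δ, Category.comp_id,
    Functor.Monoidal.whiskerRight_δ_μ_assoc, Iso.inv_hom_id_assoc] at h2
  rw [h2]
  simp

lemma hb_η (X : C) :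
    (hb G (𝟙_ V) X).inv ≫ Functor.OplaxMonoidal.η (und G) ▷ X =
      X ◁ Functor.OplaxMonoidal.η (und G) ≫ (ρ_ X).hom ≫ (λ_ X).inv := by
  have h : Functor.LaxMonoidal.ε (und G) ▷ X ≫ (hb G (𝟙_ V) X).hom =
      ((λ_ X).hom ≫ (ρ_ X).inv) ≫ X ◁ Functor.LaxMonoidal.ε (und G) := by
    rw [und_ε]
    refine ((Functor.LaxMonoidal.ε G).comm X).trans ?_
    have h := congrArg Iso.hom (Center.tensorUnit_β (C := C) X)
    exact congrArg (· ≫ X ◁ (Functor.LaxMonoidal.ε G).f) h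
  have h2 := congrArg (fun t => (hb G (𝟙_ V) X).inv ≫
    Functor.OplaxMonoidal.η (und G) ▷ X ≫ t ≫ X ◁ Functor.OplaxMonoidal.η (und G)) h
  simp only [Category.assoc, Functor.Monoidal.whiskerLeft_ε_η, Category.comp_id,
    Functor.Monoidal.whiskerRight_η_ε_assoc, Iso.inv_hom_id_assoc] at h2
  rw [h2]
  simp

end

variable {M : Type u₃} [Category.{v₃} M] [MonoidalLeftAction C M]

/-- The action `U ▶ m = G(U) ▷ m` of `V` on a `C`-module category, on objects. -/
abbrev vObj (G : V ⥤ Center C) (U : V) (m : M) : M := (und G).obj U ⊙ₗ m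

/-- The isomorphism `X ▷ (U ▶ m) ≅ U ▶ (X ▷ m)` given by the inverse of the half-braiding
`σ_{G(U),X}`. -/
def vSwap (G : V ⥤ Center C) (X : C) (U : V) (m : M) :
    X ⊙ₗ vObj G U m ≅ vObj G U (X ⊙ₗ m) where
  hom := actSwap (hb G U X).inv m
  inv := actSwap (hb G U X).hom m
  hom_inv_id := by simp [actSwap]
  inv_hom_id := by simp [actSwap]

open MonoidalLeftAction

section

variable (G : V ⥤ Center C)

lemma vSwap_nat (X : C) (U : V) {m n : M} (f : m ⟶ n) :
    X ⊴ₗ (und G).obj U ⊴ₗ f ≫ (vSwap G X U n).hom =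
      (vSwap G X U m).hom ≫ (und G).obj U ⊴ₗ X ⊴ₗ f :=
  actSwap_nat _ f

lemma vSwap_nat_left {X Y : C} (f : X ⟶ Y) (U : V) (m : M) :
    f ⊵ₗ (vObj G U m) ≫ (vSwap G Y U m).hom =
      (vSwap G X U m).hom ≫ (und G).obj U ⊴ₗ f ⊵ₗ m :=
  actSwap_nat_left _ _ f (hb_nat G U f) m

lemma vSwap_nat_map (X : C) {U W : V} (g : U ⟶ W) (m : M) :
    X ⊴ₗ (und G).map g ⊵ₗ m ≫ (vSwap G X W m).hom =
      (vSwap G X U m).hom ≫ (und G).map g ⊵ₗ (X ⊙ₗ m) :=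
  actSwap_nat_mid _ _ _ (hb_map G g X) m

lemma vSwap_tensor (X Y : C) (U : V) (m : M) :
    (vSwap G (X ⊗ Y) U m).hom ≫ (und G).obj U ⊴ₗ (αₗ X Y m).hom =
      (αₗ X Y (vObj G U m)).hom ≫ X ⊴ₗ (vSwap G Y U m).hom ≫ (vSwap G X U (Y ⊙ₗ m)).hom :=
  actSwap_tensor _ _ _ (hb_tensor_inv G U X Y) m

lemma vSwap_unit_left (U : V) (m : M) :
    (vSwap G (𝟙_ C) U m).hom ≫ (und G).obj U ⊴ₗ (λₗ m).hom = (λₗ (vObj G U m)).hom :=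
  actSwap_unit_left _ (hb_unit G U) m

end

variable [MonoidalCategory V] (G : V ⥤ Center C) [G.Monoidal]

/-- The associativity isomorphism `(U ⊗ W) ▶ m ≅ U ▶ (W ▶ m)`. -/
def vAssoc (U W : V) (m : M) : vObj G (U ⊗ W) m ≅ vObj G U (vObj G W m) where
  hom := Functor.OplaxMonoidal.δ (und G) U W ⊵ₗ m ≫ (αₗ ((und G).obj U) ((und G).obj W) m).hom
  inv := (αₗ ((und G).obj U) ((und G).obj W) m).inv ≫ Functor.LaxMonoidal.μ (und G) U W ⊵ₗ m
  hom_inv_id := by simp [← MonoidalLeftAction.comp_actionHomLeft]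
  inv_hom_id := by simp [← MonoidalLeftAction.comp_actionHomLeft_assoc]

/-- The unit isomorphism `1 ▶ m ≅ m`. -/
def vUnit (m : M) : vObj G (𝟙_ V) m ≅ m where
  hom := Functor.OplaxMonoidal.η (und G) ⊵ₗ m ≫ (λₗ m).hom
  inv := (λₗ m).inv ≫ Functor.LaxMonoidal.ε (und G) ⊵ₗ m
  hom_inv_id := by simp [← MonoidalLeftAction.comp_actionHomLeft]
  inv_hom_id := by simp [← MonoidalLeftAction.comp_actionHomLeft_assoc]

lemma vAssoc_nat (U W : V) {m n : M} (f : m ⟶ n) :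
    (und G).obj (U ⊗ W) ⊴ₗ f ≫ (vAssoc G U W n).hom =
      (vAssoc G U W m).hom ≫ (und G).obj U ⊴ₗ (und G).obj W ⊴ₗ f := by
  simp only [vAssoc, action_exchange_assoc, tensor_actionHomRight, Category.assoc,
    Iso.inv_hom_id, Category.comp_id]

lemma vUnit_nat {m n : M} (f : m ⟶ n) :
    (und G).obj (𝟙_ V) ⊴ₗ f ≫ (vUnit G n).hom = (vUnit G m).hom ≫ f := by
  simp only [vUnit, action_exchange_assoc, unit_actionHomRight, Category.assoc,
    Iso.inv_hom_id, Category.comp_id]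

lemma vSwap_assoc (X : C) (U W : V) (m : M) :
    (vSwap G X (U ⊗ W) m).hom ≫ (vAssoc G U W (X ⊙ₗ m)).hom =
      X ⊴ₗ (vAssoc G U W m).hom ≫ (vSwap G X U (vObj G W m)).hom ≫
        (und G).obj U ⊴ₗ (vSwap G X W m).hom :=
  actSwap_assoc _ _ _ _ (hb_δ G U W X) m

lemma vSwap_unit (X : C) (m : M) :
    (vSwap G X (𝟙_ V) m).hom ≫ (vUnit G (X ⊙ₗ m)).hom = X ⊴ₗ (vUnit G m).hom :=
  actSwap_unit _ _ (hb_η G X) m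

end VAction

/-! ### `V`-module endofunctors -/

section VEnd

open MonoidalLeftAction

/-- `M` is a module category over `C`: the action is `k`-bilinear and exact in each variable. -/
class IsModuleCategory (k : Type w) [Field k]
    (C : Type u₂) [Category.{v₂} C] [MonoidalCategory C] [Preadditive C] [Linear k C]
    (M : Type u₃) [Category.{v₃} M] [Preadditive M] [Linear k M]
    [MonoidalLeftAction C M] : Prop where
  additive_left (X : C) : (actionLeft M X).Additive
  linear_left (X : C) : (actionLeft M X).Linear k
  preservesFiniteLimits_left (X : C) : PreservesFiniteLimits (actionLeft M X)
  preservesFiniteColimits_left (X : C) : PreservesFiniteColimits (actionLeft M X)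
  additive_right (m : M) : (actionRight C m).Additive
  linear_right (m : M) : (actionRight C m).Linear k
  preservesFiniteLimits_right (m : M) : PreservesFiniteLimits (actionRight C m)
  preservesFiniteColimits_right (m : M) : PreservesFiniteColimits (actionRight C m)

variable (k : Type w) [Field k]
  {V : Type u₁} [Category.{v₁} V] [MonoidalCategory V]
  {C : Type u₂} [Category.{v₂} C] [MonoidalCategory C]
  (G : V ⥤ Center C) [G.Monoidal]
  (M : Type u₃) [Category.{v₃} M] [Preadditive M] [Linear k M] [MonoidalLeftAction C M]

/-- The objects of `End_V(M)`: `k`-linear functors `F : M ⥤ M` with a structure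
`d_{U,m} : F(U ▶ m) ≅ U ▶ F(m)` of a module functor for the action `U ▶ m = G(U) ▷ m`. -/
structure VEnd where
  functor : M ⥤ M
  additive : functor.Additive
  linear : functor.Linear k
  d (U : V) (m : M) : functor.obj (vObj G U m) ≅ vObj G U (functor.obj m)
  d_nat (U : V) {m n : M} (f : m ⟶ n) :
    functor.map ((und G).obj U ⊴ₗ f) ≫ (d U n).hom =
      (d U m).hom ≫ (und G).obj U ⊴ₗ functor.map f
  d_nat_left {U W : V} (g : U ⟶ W) (m : M) :
    functor.map ((und G).map g ⊵ₗ m) ≫ (d W m).hom =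
      (d U m).hom ≫ (und G).map g ⊵ₗ functor.obj m
  d_tensor (U W : V) (m : M) :
    (d (U ⊗ W) m).hom ≫ (vAssoc G U W (functor.obj m)).hom =
      functor.map (vAssoc G U W m).hom ≫ (d U (vObj G W m)).hom ≫
        (und G).obj U ⊴ₗ (d W m).hom
  d_unit (m : M) :
    (d (𝟙_ V) m).hom ≫ (vUnit G (functor.obj m)).hom = functor.map (vUnit G m).hom

namespace VEnd

attribute [instance] VEnd.additive VEnd.linear

variable {k G M}

/-- Natural module transformations between `V`-module functors. -/
@[ext]
structure Hom (F F' : VEnd k G M) where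
  app (m : M) : F.functor.obj m ⟶ F'.functor.obj m
  naturality {m n : M} (f : m ⟶ n) : F.functor.map f ≫ app n = app m ≫ F'.functor.map f
  comm (U : V) (m : M) :
    app (vObj G U m) ≫ (F'.d U m).hom = (F.d U m).hom ≫ (und G).obj U ⊴ₗ app m

instance : Category (VEnd k G M) where
  Hom F F' := Hom F F'
  id F := { app := fun m => 𝟙 _, naturality := by simp, comm := by simp }
  comp α β :=
    { app := fun m => α.app m ≫ β.app m
      naturality := by
        intro m n f
        rw [← Category.assoc, α.naturality, Category.assoc, β.naturality, Category.assoc]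
      comm := by
        intro U m
        rw [Category.assoc, β.comm, ← Category.assoc, α.comm, Category.assoc,
          actionHomRight_comp] }
  id_comp α := by ext; exact Category.id_comp _
  comp_id α := by ext; exact Category.comp_id _
  assoc α β γ := by ext; exact Category.assoc _ _ _

@[ext]
lemma hom_ext {F F' : VEnd k G M} {α β : F ⟶ F'} (h : ∀ m, α.app m = β.app m) : α = β :=
  Hom.ext (funext h)

@[simp] lemma id_app (F : VEnd k G M) (m : M) : Hom.app (𝟙 F) m = 𝟙 (F.functor.obj m) := rfl

@[simp] lemma comp_app {F F' F'' : VEnd k G M} (α : F ⟶ F') (β : F' ⟶ F'') (m : M) :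
    (α ≫ β).app m = α.app m ≫ β.app m := rfl

/-- An isomorphism in `End_V(M)` from isomorphisms of the components. -/
@[simps]
def isoMk {F F' : VEnd k G M} (e : ∀ m, F.functor.obj m ≅ F'.functor.obj m)
    (h₁ : ∀ {m n : M} (f : m ⟶ n),
      F.functor.map f ≫ (e n).hom = (e m).hom ≫ F'.functor.map f)
    (h₂ : ∀ (U : V) (m : M),
      (e (vObj G U m)).hom ≫ (F'.d U m).hom = (F.d U m).hom ≫ (und G).obj U ⊴ₗ (e m).hom) :
    F ≅ F' where
  hom := { app := fun m => (e m).hom, naturality := h₁, comm := h₂ }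
  inv :=
    { app := fun m => (e m).inv
      naturality := fun {m n} f => by
        rw [← cancel_epi (e m).hom, ← cancel_mono (e n).hom]
        simp [h₁]
      comm := fun U m => by
        rw [← cancel_epi (e (vObj G U m)).hom,
          ← cancel_mono ((und G).obj U ⊴ₗ (e m).hom)]
        simp [← h₂] }
  hom_inv_id := by ext m; simp
  inv_hom_id := by ext m; simp

variable [Preadditive C] [Linear k C] [IsModuleCategory k C M]

/-- The left action `X ▷ (F, d)`, with `X ▷ F(U ▶ m) ≅ X ▷ (U ▶ F(m)) ≅ U ▶ (X ▷ F(m))`. -/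
abbrev lact (X : C) (F : VEnd k G M) : VEnd k G M where
  functor :=
    { obj := fun m => X ⊙ₗ F.functor.obj m
      map := fun f => X ⊴ₗ F.functor.map f }
  additive := by
    refine ⟨fun {m n f g} => ?_⟩
    have := IsModuleCategory.additive_left (k := k) (M := M) X
    change X ⊴ₗ F.functor.map (f + g) = X ⊴ₗ F.functor.map f + X ⊴ₗ F.functor.map g
    rw [F.functor.map_add]
    exact (actionLeft M X).map_add
  linear := by
    refine ⟨fun {m n} f r => ?_⟩
    have := IsModuleCategory.linear_left (k := k) (M := M) X
    change X ⊴ₗ F.functor.map (r • f) = r • X ⊴ₗ F.functor.map f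
    rw [F.functor.map_smul]
    exact (actionLeft M X).map_smul r _
  d U m :=
    { hom := X ⊴ₗ (F.d U m).hom ≫ (vSwap G X U (F.functor.obj m)).hom
      inv := (vSwap G X U (F.functor.obj m)).inv ≫ X ⊴ₗ (F.d U m).inv }
  d_nat U m n f := by
    simp only [Category.assoc]
    rw [← vSwap_nat, ← actionHomRight_comp_assoc, ← actionHomRight_comp_assoc, F.d_nat]
  d_nat_left g m := by
    simp only [Category.assoc]
    rw [← vSwap_nat_map, ← actionHomRight_comp_assoc, ← actionHomRight_comp_assoc, F.d_nat_left]
  d_tensor U W m := by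
    simp only [Category.assoc, actionHomRight_comp]
    rw [vSwap_assoc, ← reassoc_of% vSwap_nat G X U (F.d W m).hom]
    simp only [← actionHomRight_comp_assoc, F.d_tensor]
  d_unit m := by
    rw [Category.assoc, vSwap_unit, ← actionHomRight_comp, F.d_unit]

/-- The right action `(F, d) ◁ X`, with `F(X ▷ (U ▶ m)) ≅ F(U ▶ (X ▷ m)) ≅ U ▶ F(X ▷ m)`. -/
abbrev ract (F : VEnd k G M) (X : C) : VEnd k G M where
  functor :=
    { obj := fun m => F.functor.obj (X ⊙ₗ m)
      map := fun f => F.functor.map (X ⊴ₗ f)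
      map_id := by simp
      map_comp := by intros; rw [actionHomRight_comp, F.functor.map_comp] }
  additive := by
    refine ⟨fun {m n f g} => ?_⟩
    have := IsModuleCategory.additive_left (k := k) (M := M) X
    have h : X ⊴ₗ (f + g) = X ⊴ₗ f + X ⊴ₗ g := (actionLeft M X).map_add
    change F.functor.map (X ⊴ₗ (f + g)) = F.functor.map (X ⊴ₗ f) + F.functor.map (X ⊴ₗ g)
    rw [h, F.functor.map_add]
  linear := by
    refine ⟨fun {m n} f r => ?_⟩
    have := IsModuleCategory.linear_left (k := k) (M := M) X
    have h : X ⊴ₗ (r • f) = r • X ⊴ₗ f := (actionLeft M X).map_smul r f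
    change F.functor.map (X ⊴ₗ (r • f)) = r • F.functor.map (X ⊴ₗ f)
    rw [h, F.functor.map_smul]
  d U m := F.functor.mapIso (vSwap G X U m) ≪≫ F.d U (X ⊙ₗ m)
  d_nat U m n f := by
    simp only [Iso.trans_hom, Functor.mapIso_hom, Category.assoc]
    rw [← F.d_nat, ← F.functor.map_comp_assoc, vSwap_nat, F.functor.map_comp_assoc]
  d_nat_left g m := by
    simp only [Iso.trans_hom, Functor.mapIso_hom, Category.assoc]
    rw [← F.d_nat_left, ← F.functor.map_comp_assoc, vSwap_nat_map, F.functor.map_comp_assoc]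
  d_tensor U W m := by
    simp only [Iso.trans_hom, Functor.mapIso_hom, Category.assoc, actionHomRight_comp]
    rw [F.d_tensor, ← F.functor.map_comp_assoc, vSwap_assoc,
      ← reassoc_of% F.d_nat U (vSwap G X W m).hom]
    simp only [Category.assoc, Functor.map_comp]
  d_unit m := by
    simp only [Iso.trans_hom, Functor.mapIso_hom, Category.assoc]
    rw [F.d_unit, ← F.functor.map_comp, vSwap_unit]

/-- `id_X ▷ α` -/
@[simps]
def lactMap (X : C) {F F' : VEnd k G M} (α : F ⟶ F') : lact X F ⟶ lact X F' where
  app m := X ⊴ₗ α.app m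
  naturality f := by
    change X ⊴ₗ F.functor.map f ≫ X ⊴ₗ α.app _ = X ⊴ₗ α.app _ ≫ X ⊴ₗ F'.functor.map f
    rw [← actionHomRight_comp, α.naturality, actionHomRight_comp]
  comm U m := by
    change X ⊴ₗ α.app (vObj G U m) ≫ X ⊴ₗ (F'.d U m).hom ≫ (vSwap G X U (F'.functor.obj m)).hom =
      (X ⊴ₗ (F.d U m).hom ≫ (vSwap G X U (F.functor.obj m)).hom) ≫
        (und G).obj U ⊴ₗ X ⊴ₗ α.app m
    rw [Category.assoc, ← vSwap_nat, ← actionHomRight_comp_assoc, α.comm,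
      actionHomRight_comp_assoc]

/-- `f ▷ id_F` -/
@[simps]
def lactMapLeft {X Y : C} (f : X ⟶ Y) (F : VEnd k G M) : lact X F ⟶ lact Y F where
  app m := f ⊵ₗ F.functor.obj m
  naturality g := by
    change X ⊴ₗ F.functor.map g ≫ f ⊵ₗ _ = f ⊵ₗ _ ≫ Y ⊴ₗ F.functor.map g
    rw [action_exchange]
  comm U m := by
    change f ⊵ₗ F.functor.obj (vObj G U m) ≫ Y ⊴ₗ (F.d U m).hom ≫
      (vSwap G Y U (F.functor.obj m)).hom =
      (X ⊴ₗ (F.d U m).hom ≫ (vSwap G X U (F.functor.obj m)).hom) ≫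
        (und G).obj U ⊴ₗ f ⊵ₗ F.functor.obj m
    rw [Category.assoc, ← vSwap_nat_left, ← action_exchange_assoc]

/-- `α ◁ id_X` -/
@[simps]
def ractMap {F F' : VEnd k G M} (α : F ⟶ F') (X : C) : ract F X ⟶ ract F' X where
  app m := α.app (X ⊙ₗ m)
  naturality f := α.naturality _
  comm U m := by
    change α.app (X ⊙ₗ vObj G U m) ≫ F'.functor.map (vSwap G X U m).hom ≫
      (F'.d U (X ⊙ₗ m)).hom =
      (F.functor.map (vSwap G X U m).hom ≫ (F.d U (X ⊙ₗ m)).hom) ≫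
        (und G).obj U ⊴ₗ α.app (X ⊙ₗ m)
    rw [Category.assoc, ← α.comm, ← reassoc_of% α.naturality (vSwap G X U m).hom]

/-- `id_F ◁ f` -/
@[simps]
def ractMapRight (F : VEnd k G M) {X Y : C} (f : X ⟶ Y) : ract F X ⟶ ract F Y where
  app m := F.functor.map (f ⊵ₗ m)
  naturality g := by
    change F.functor.map (X ⊴ₗ g) ≫ F.functor.map (f ⊵ₗ _) =
      F.functor.map (f ⊵ₗ _) ≫ F.functor.map (Y ⊴ₗ g)
    rw [← F.functor.map_comp, action_exchange, F.functor.map_comp]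
  comm U m := by
    change F.functor.map (f ⊵ₗ vObj G U m) ≫ F.functor.map (vSwap G Y U m).hom ≫
      (F.d U (Y ⊙ₗ m)).hom =
      (F.functor.map (vSwap G X U m).hom ≫ (F.d U (X ⊙ₗ m)).hom) ≫
        (und G).obj U ⊴ₗ F.functor.map (f ⊵ₗ m)
    rw [Category.assoc, ← F.d_nat, ← F.functor.map_comp_assoc, vSwap_nat_left,
      F.functor.map_comp_assoc]

/-- `(X ⊗ Y) ▷ F ≅ X ▷ (Y ▷ F)` -/
def lactAssoc (X Y : C) (F : VEnd k G M) : lact (X ⊗ Y) F ≅ lact X (lact Y F) :=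
  isoMk (fun m => αₗ X Y (F.functor.obj m))
    (fun f => by
      change (X ⊗ Y) ⊴ₗ F.functor.map f ≫ _ = _ ≫ X ⊴ₗ Y ⊴ₗ F.functor.map f
      simp)
    (fun U m => by
      change (αₗ X Y _).hom ≫ X ⊴ₗ (Y ⊴ₗ (F.d U m).hom ≫ (vSwap G Y U _).hom) ≫
        (vSwap G X U _).hom = ((X ⊗ Y) ⊴ₗ (F.d U m).hom ≫ (vSwap G (X ⊗ Y) U _).hom) ≫
          (und G).obj U ⊴ₗ (αₗ X Y _).hom
      rw [Category.assoc, vSwap_tensor]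
      simp)

/-- `1 ▷ F ≅ F` -/
def lactUnit (F : VEnd k G M) : lact (𝟙_ C) F ≅ F :=
  isoMk (fun m => λₗ (F.functor.obj m))
    (fun f => by
      change 𝟙_ C ⊴ₗ F.functor.map f ≫ _ = _ ≫ F.functor.map f
      simp)
    (fun U m => by
      change (λₗ _).hom ≫ (F.d U m).hom =
        (𝟙_ C ⊴ₗ (F.d U m).hom ≫ (vSwap G (𝟙_ C) U _).hom) ≫ (und G).obj U ⊴ₗ (λₗ _).hom
      rw [Category.assoc, vSwap_unit_left]
      simp)

/-- `F ◁ (X ⊗ Y) ≅ (F ◁ X) ◁ Y` -/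
def ractAssoc (F : VEnd k G M) (X Y : C) : ract F (X ⊗ Y) ≅ ract (ract F X) Y :=
  isoMk (fun m => F.functor.mapIso (αₗ X Y m))
    (fun f => by
      change F.functor.map ((X ⊗ Y) ⊴ₗ f) ≫ F.functor.map _ =
        F.functor.map _ ≫ F.functor.map (X ⊴ₗ Y ⊴ₗ f)
      rw [← F.functor.map_comp, ← F.functor.map_comp]
      simp)
    (fun U m => by
      change F.functor.map (αₗ X Y _).hom ≫ F.functor.map (X ⊴ₗ (vSwap G Y U m).hom) ≫
        F.functor.map (vSwap G X U _).hom ≫ (F.d U _).hom =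
        (F.functor.map (vSwap G (X ⊗ Y) U m).hom ≫ (F.d U _).hom) ≫
          (und G).obj U ⊴ₗ F.functor.map (αₗ X Y _).hom
      rw [Category.assoc, ← F.d_nat, ← F.functor.map_comp_assoc, ← F.functor.map_comp_assoc,
        ← F.functor.map_comp_assoc, vSwap_tensor]
      simp)

/-- `F ◁ 1 ≅ F` -/
def ractUnit (F : VEnd k G M) : ract F (𝟙_ C) ≅ F :=
  isoMk (fun m => F.functor.mapIso (λₗ m))
    (fun f => by
      change F.functor.map (𝟙_ C ⊴ₗ f) ≫ F.functor.map _ = F.functor.map _ ≫ F.functor.map f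
      rw [← F.functor.map_comp, ← F.functor.map_comp]
      simp)
    (fun U m => by
      change F.functor.map (λₗ _).hom ≫ (F.d U m).hom =
        (F.functor.map (vSwap G (𝟙_ C) U m).hom ≫ (F.d U _).hom) ≫
          (und G).obj U ⊴ₗ F.functor.map (λₗ _).hom
      rw [Category.assoc, ← F.d_nat, ← F.functor.map_comp_assoc, vSwap_unit_left])

/-- `(X ▷ F) ◁ Y ≅ X ▷ (F ◁ Y)` -/
def midAssoc (X : C) (F : VEnd k G M) (Y : C) : ract (lact X F) Y ≅ lact X (ract F Y) :=
  isoMk (fun m => Iso.refl (X ⊙ₗ F.functor.obj (Y ⊙ₗ m)))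
    (fun f => by
      change X ⊴ₗ F.functor.map (Y ⊴ₗ f) ≫ 𝟙 _ = 𝟙 _ ≫ X ⊴ₗ F.functor.map (Y ⊴ₗ f)
      simp)
    (fun U m => by
      change 𝟙 _ ≫ X ⊴ₗ (F.functor.map (vSwap G Y U m).hom ≫ (F.d U _).hom) ≫
        (vSwap G X U _).hom = (X ⊴ₗ F.functor.map (vSwap G Y U m).hom ≫ X ⊴ₗ (F.d U _).hom ≫
          (vSwap G X U _).hom) ≫ (und G).obj U ⊴ₗ 𝟙 _
      simp)

instance : MonoidalLeftAction C (VEnd k G M) where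
  actionObj := lact
  actionHomLeft := lactMapLeft
  actionHomRight := lactMap
  actionAssocIso := lactAssoc
  actionUnitIso := lactUnit
  actionHomRight_id X F := by
    ext m
    exact actionHomRight_id X (F.functor.obj m)
  id_actionHomLeft X F := by
    ext m
    exact id_actionHomLeft X (F.functor.obj m)
  actionHom_comp f₁ f₂ g₁ g₂ := by
    ext m
    change (f₁ ≫ f₂) ⊵ₗ _ ≫ _ ⊴ₗ (g₁.app m ≫ g₂.app m) =
      (f₁ ⊵ₗ _ ≫ _ ⊴ₗ g₁.app m) ≫ f₂ ⊵ₗ _ ≫ _ ⊴ₗ g₂.app m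
    rw [← actionHom_def, actionHom_comp, actionHom_def, actionHom_def]
  actionAssocIso_hom_naturality f g h := by
    ext m
    have := actionAssocIso_hom_naturality f g (h.app m)
    simp only [actionHom_def] at this
    exact this
  actionUnitIso_hom_naturality f := by
    ext m
    exact actionUnitIso_hom_naturality (C := C) (f.app m)
  whiskerLeft_actionHomLeft X Y Z f F := by
    ext m
    exact whiskerLeft_actionHomLeft X f (F.functor.obj m)
  whiskerRight_actionHomLeft Z f F := by
    ext m
    exact whiskerRight_actionHomLeft Z f (F.functor.obj m)
  associator_actionHom X Y Z F := by
    ext m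
    exact associator_actionHom X Y Z (F.functor.obj m)
  leftUnitor_actionHom X F := by
    ext m
    exact leftUnitor_actionHom X (F.functor.obj m)
  rightUnitor_actionHom X F := by
    ext m
    exact rightUnitor_actionHom X (F.functor.obj m)

instance : MonoidalRightAction C (VEnd k G M) where
  actionObj := ract
  actionHomLeft := ractMap
  actionHomRight := ractMapRight
  actionAssocIso := ractAssoc
  actionUnitIso := ractUnit
  actionHomRight_id X F := by
    ext m
    change F.functor.map (𝟙 X ⊵ₗ m) = 𝟙 _
    simp
  id_actionHomLeft X F := by
    ext m
    rfl
  actionHom_comp {X Y Z F F' F''} f₁ f₂ g₁ g₂ := by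
    ext m
    change (f₁.app _ ≫ f₂.app _) ≫ F''.functor.map ((g₁ ≫ g₂) ⊵ₗ m) =
      (f₁.app _ ≫ F'.functor.map (g₁ ⊵ₗ m)) ≫ f₂.app _ ≫ F''.functor.map (g₂ ⊵ₗ m)
    rw [comp_actionHomLeft, Functor.map_comp, Category.assoc, Category.assoc,
      ← reassoc_of% f₂.naturality]
  actionAssocIso_hom_naturality {F F' X X' Y Y'} f g h := by
    ext m
    change (f.app _ ≫ F'.functor.map ((g ⊗ₘ h) ⊵ₗ m)) ≫ F'.functor.map (αₗ _ _ _).hom =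
      F.functor.map (αₗ _ _ _).hom ≫ (f.app (X ⊙ₗ Y ⊙ₗ m) ≫ F'.functor.map (g ⊵ₗ (Y ⊙ₗ m))) ≫
        F'.functor.map (X' ⊴ₗ h ⊵ₗ m)
    have := actionAssocIso_hom_naturality g h (𝟙 m)
    simp only [actionHom_def, actionHomRight_id, Category.comp_id] at this
    rw [Category.assoc, Category.assoc, ← Functor.map_comp, ← Functor.map_comp, this,
      Functor.map_comp, ← reassoc_of% f.naturality]
  actionUnitIso_hom_naturality f := by
    ext m
    exact f.naturality _
  actionHomRight_whiskerRight {X Y} f Z F := by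
    ext m
    change F.functor.map ((f ▷ Z) ⊵ₗ m) = F.functor.map (αₗ _ _ _).hom ≫
      F.functor.map (f ⊵ₗ (Z ⊙ₗ m)) ≫ F.functor.map (αₗ _ _ _).inv
    rw [← F.functor.map_comp, ← F.functor.map_comp, whiskerRight_actionHomLeft]
  whiskerRight_actionHomLeft Z X Y f F := by
    ext m
    change F.functor.map ((Z ◁ f) ⊵ₗ m) = F.functor.map (αₗ _ _ _).hom ≫
      F.functor.map (Z ⊴ₗ (f ⊵ₗ m)) ≫ F.functor.map (αₗ _ _ _).inv
    rw [← F.functor.map_comp, ← F.functor.map_comp, whiskerLeft_actionHomLeft]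
  actionHom_associator X Y Z F := by
    ext m
    change F.functor.map ((α_ X Y Z).hom ⊵ₗ m) ≫ F.functor.map (αₗ _ _ _).hom ≫
      F.functor.map (X ⊴ₗ (αₗ _ _ _).hom) = F.functor.map (αₗ _ _ _).hom ≫
      F.functor.map (αₗ _ _ _).hom
    rw [← F.functor.map_comp, ← F.functor.map_comp, ← F.functor.map_comp, associator_actionHom]
  actionHom_leftUnitor X F := by
    ext m
    change F.functor.map ((λ_ X).hom ⊵ₗ m) = F.functor.map (αₗ _ _ _).hom ≫
      F.functor.map (λₗ _).hom
    rw [← F.functor.map_comp, leftUnitor_actionHom]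
  actionHom_rightUnitor X F := by
    ext m
    change F.functor.map ((ρ_ X).hom ⊵ₗ m) = F.functor.map (αₗ _ _ _).hom ≫
      F.functor.map (X ⊴ₗ (λₗ _).hom)
    rw [← F.functor.map_comp, rightUnitor_actionHom]

/-- The functor `ρ : C ⥤ End_V(M)`, `ρ(X) = X ▷ -`. -/
abbrev rhoObj (X : C) : VEnd k G M where
  functor := actionLeft M X
  additive := IsModuleCategory.additive_left (k := k) X
  linear := IsModuleCategory.linear_left X
  d U m := vSwap G X U m
  d_nat U _ _ f := vSwap_nat G X U f
  d_nat_left g m := vSwap_nat_map G X g m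
  d_tensor U W m := vSwap_assoc G X U W m
  d_unit m := vSwap_unit G X m

variable (k G M) in
/-- The functor `ρ : C ⥤ End_V(M)`, `ρ(X) = X ▷ -`. -/
@[simps]
def rho : C ⥤ VEnd k G M where
  obj := rhoObj
  map f :=
    { app := fun m => f ⊵ₗ m
      naturality := fun g => action_exchange f g
      comm := fun U m => vSwap_nat_left G f U m }
  map_id X := by ext m; exact id_actionHomLeft X m
  map_comp f g := by ext m; exact comp_actionHomLeft f g m

/-- `ρ(X ⊗ Y) ≅ X ▷ ρ(Y)` -/
def rhoLeft (X Y : C) : (rho k G M).obj (X ⊗ Y) ≅ X ⊙ₗ (rho k G M).obj Y :=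
  isoMk (fun m => αₗ X Y m)
    (fun f => by
      change (X ⊗ Y) ⊴ₗ f ≫ _ = _ ≫ X ⊴ₗ Y ⊴ₗ f
      simp)
    (fun U m => by
      exact (vSwap_tensor G X Y U m).symm)

/-- `ρ(X ⊗ Y) ≅ ρ(X) ◁ Y` -/
def rhoRight (X Y : C) : (rho k G M).obj (X ⊗ Y) ≅ (rho k G M).obj X ⊙ᵣ Y :=
  isoMk (fun m => αₗ X Y m)
    (fun f => by
      change (X ⊗ Y) ⊴ₗ f ≫ _ = _ ≫ X ⊴ₗ Y ⊴ₗ f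
      simp)
    (fun U m => by
      refine Eq.trans ?_ (vSwap_tensor G X Y U m).symm
      rfl)

end VEnd

end VEnd

/-! ### Evaluation morphisms -/

section Evaluation

open MonoidalLeftAction

variable {C : Type u₂} [Category.{v₂} C] [MonoidalCategory C]
  {M : Type u₃} [Category.{v₃} M] [MonoidalLeftAction C M]

/-- The morphism `Y ▷ (X ▷ m) ⟶ m` induced by `e : Y ⊗ X ⟶ 1`. -/
def actEv {X Y : C} (e : Y ⊗ X ⟶ 𝟙_ C) (m : M) : Y ⊙ₗ X ⊙ₗ m ⟶ m :=
  (αₗ Y X m).inv ≫ e ⊵ₗ m ≫ (λₗ m).hom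

lemma actEv_nat {X Y : C} (e : Y ⊗ X ⟶ 𝟙_ C) {m n : M} (f : m ⟶ n) :
    Y ⊴ₗ X ⊴ₗ f ≫ actEv e n = actEv e m ≫ f := by
  rw [← cancel_epi (αₗ Y X m).hom]
  simp only [actEv, Iso.hom_inv_id_assoc, Category.assoc, actionUnitIso_hom_naturality]
  rw [← action_exchange_assoc, tensor_actionHomRight]
  simp

lemma actEv_zigzag {X Y : C} (e : Y ⊗ X ⟶ 𝟙_ C) (c : 𝟙_ C ⟶ X ⊗ Y)
    (h : c ▷ X ≫ (α_ X Y X).hom ≫ X ◁ e = (λ_ X).hom ≫ (ρ_ X).inv) (m : M) :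
    c ⊵ₗ (X ⊙ₗ m) ≫ (αₗ X Y (X ⊙ₗ m)).hom ≫ X ⊴ₗ actEv e m = (λₗ (X ⊙ₗ m)).hom := by
  have h' := congrArg (fun t => t ⊵ₗ m ≫ (ρ_ X).hom ⊵ₗ m) h
  simp only [comp_actionHomLeft, Category.assoc, assoc_hom_act, whiskerLeft_actionHomLeft,
    whiskerRight_actionHomLeft, leftUnitor_actionHom, rightUnitor_actionHom,
    rightUnitor_inv_act, Iso.inv_hom_id_assoc] at h'
  replace h' := (cancel_epi _).1 h'
  simp only [← actionHomRight_comp, Iso.inv_hom_id, actionHomRight_id, Category.comp_id] at h'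
  exact h'

lemma act_coev_nat {X Y : C} (c : 𝟙_ C ⟶ X ⊗ Y) {m n : M} (f : m ⟶ n) :
    f ≫ (λₗ n).inv ≫ c ⊵ₗ n ≫ (αₗ X Y n).hom =
      (λₗ m).inv ≫ c ⊵ₗ m ≫ (αₗ X Y m).hom ≫ X ⊴ₗ Y ⊴ₗ f := by
  rw [← cancel_mono (αₗ X Y n).inv]
  simp only [Category.assoc, Iso.hom_inv_id, Category.comp_id]
  rw [← tensor_actionHomRight, ← action_exchange, unit_actionHomRight]
  simp

lemma actEv_injective {X Y : C} (e : Y ⊗ X ⟶ 𝟙_ C) (c : 𝟙_ C ⟶ X ⊗ Y)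
    (h : c ▷ X ≫ (α_ X Y X).hom ≫ X ◁ e = (λ_ X).hom ≫ (ρ_ X).inv) {m n : M}
    {f g : n ⟶ X ⊙ₗ m} (w : Y ⊴ₗ f ≫ actEv e m = Y ⊴ₗ g ≫ actEv e m) : f = g := by
  have key (f : n ⟶ X ⊙ₗ m) : f = (λₗ n).inv ≫ c ⊵ₗ n ≫ (αₗ X Y n).hom ≫
      X ⊴ₗ (Y ⊴ₗ f ≫ actEv e m) := by
    rw [actionHomRight_comp, ← reassoc_of% act_coev_nat c f, actEv_zigzag e c h,
      Iso.inv_hom_id, Category.comp_id]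
  rw [key f, key g, w]

variable {V : Type u₁} [Category.{v₁} V] [MonoidalCategory V] (G : V ⥤ Center C) [G.Monoidal]

/-- The morphism `ev_{G(U)} : G(U^*) ⊗ G(U) ⟶ 1` coming from the evaluation of `V`. -/
def undEv (U : V) [HasRightDual U] : (und G).obj Uᘁ ⊗ (und G).obj U ⟶ 𝟙_ C :=
  Functor.LaxMonoidal.μ (und G) Uᘁ U ≫ (und G).map (ε_ U Uᘁ) ≫ Functor.OplaxMonoidal.η (und G)

lemma undEv_zigzag (U : V) [HasRightDual U] :
    (Functor.LaxMonoidal.ε (und G) ≫ (und G).map (η_ U Uᘁ) ≫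
      Functor.OplaxMonoidal.δ (und G) U Uᘁ) ▷ (und G).obj U ≫ (α_ _ _ _).hom ≫
        (und G).obj U ◁ undEv G U = (λ_ _).hom ≫ (ρ_ _).inv := by
  have h := congrArg (und G).map (ExactPairing.evaluation_coevaluation U Uᘁ)
  simp only [Functor.map_comp, Functor.Monoidal.map_whiskerRight,
    Functor.Monoidal.map_whiskerLeft, Functor.Monoidal.map_associator,
    Functor.Monoidal.map_leftUnitor, Functor.Monoidal.map_rightUnitor_inv,
    Category.assoc, Functor.Monoidal.μ_δ_assoc] at h
  have h2 := congrArg (fun t => Functor.LaxMonoidal.ε (und G) ▷ _ ≫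
    Functor.LaxMonoidal.μ (und G) _ _ ≫ t ≫ Functor.OplaxMonoidal.δ (und G) _ _ ≫
      _ ◁ Functor.OplaxMonoidal.η (und G)) h
  simp only [Category.assoc, Functor.Monoidal.μ_δ_assoc] at h2
  simp only [undEv, comp_whiskerRight, MonoidalCategory.whiskerLeft_comp, Category.assoc]
  refine h2.trans ?_
  simp
/-- The evaluation `ev_U ▶ m : U^* ▶ (U ▶ m) ≅ (U^* ⊗ U) ▶ m ⟶ 1 ▶ m ≅ m`. -/
def vEv (U : V) [HasRightDual U] (m : M) : vObj G Uᘁ (vObj G U m) ⟶ m :=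
  (vAssoc G Uᘁ U m).inv ≫ (und G).map (ε_ U Uᘁ) ⊵ₗ m ≫ (vUnit G m).hom

lemma vEv_eq (U : V) [HasRightDual U] (m : M) : vEv G U m = actEv (undEv G U) m := by
  simp [vEv, actEv, undEv, vAssoc, vUnit]

lemma vEv_nat (U : V) [HasRightDual U] {m n : M} (f : m ⟶ n) :
    (und G).obj Uᘁ ⊴ₗ (und G).obj U ⊴ₗ f ≫ vEv G U n = vEv G U m ≫ f := by
  rw [vEv_eq, vEv_eq, actEv_nat]

lemma vEv_injective (U : V) [HasRightDual U] {m n : M} {f g : n ⟶ vObj G U m}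
    (w : (und G).obj Uᘁ ⊴ₗ f ≫ vEv G U m = (und G).obj Uᘁ ⊴ₗ g ≫ vEv G U m) : f = g :=
  actEv_injective (undEv G U) _ (undEv_zigzag G U) (by rwa [vEv_eq] at w)

lemma vSwap_vEv (X : C) (U : V) [HasRightDual U] (m : M) :
    X ⊴ₗ vEv G U m = (vSwap G X Uᘁ (vObj G U m)).hom ≫
      (und G).obj Uᘁ ⊴ₗ (vSwap G X U m).hom ≫ vEv G U (X ⊙ₗ m) := by
  rw [vEv, vEv, actionHomRight_comp, actionHomRight_comp, ← vSwap_unit,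
    reassoc_of% vSwap_nat_map G X (ε_ U Uᘁ) m,
    ← cancel_epi (X ⊴ₗ (vAssoc G Uᘁ U m).hom), ← actionHomRight_comp_assoc]
  simp only [Iso.hom_inv_id, actionHomRight_id, Category.id_comp]
  rw [← reassoc_of% vSwap_assoc G X Uᘁ U m, Iso.hom_inv_id_assoc]

end Evaluation

/-! ### Internal Homs -/

section InternalHom

open MonoidalLeftAction

variable {C : Type u₂} [Category.{v₂} C] [MonoidalCategory C]
  {M : Type u₃} [Category.{v₃} M] [MonoidalLeftAction C M]

variable (C) in
/-- An internal Hom from `m` to `n`: an object of `C` with a representation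
`φ^X : Hom_C(X, obj) ≃ Hom_M(X ▷ m, n)` of the functor `Hom_M(- ▷ m, n)`. -/
structure InternalHom (m n : M) where
  obj : C
  homEquiv (X : C) : (X ⟶ obj) ≃ (X ⊙ₗ m ⟶ n)
  homEquiv_naturality {X Y : C} (h : X ⟶ Y) (f : Y ⟶ obj) :
    homEquiv X (h ≫ f) = h ⊵ₗ m ≫ homEquiv Y f

namespace InternalHom

variable {m n : M} (H : InternalHom C m n)

/-- The evaluation `φ(id) : Hom(m, n) ▷ m ⟶ n`. -/
def ev : H.obj ⊙ₗ m ⟶ n := H.homEquiv H.obj (𝟙 _)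

/-- The inverse `ψ^X : Hom_M(X ▷ m, n) → Hom_C(X, Hom(m, n))` of `φ^X`. -/
def psi {X : C} (f : X ⊙ₗ m ⟶ n) : X ⟶ H.obj := (H.homEquiv X).symm f

lemma homEquiv_eq {X : C} (f : X ⟶ H.obj) : H.homEquiv X f = f ⊵ₗ m ≫ H.ev := by
  rw [ev, ← H.homEquiv_naturality, Category.comp_id]

@[simp]
lemma psi_ev {X : C} (f : X ⊙ₗ m ⟶ n) : H.psi f ⊵ₗ m ≫ H.ev = f := by
  rw [← homEquiv_eq, psi, Equiv.apply_symm_apply]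

lemma psi_ev_assoc {X : C} (f : X ⊙ₗ m ⟶ n) {p : M} (g : n ⟶ p) :
    H.psi f ⊵ₗ m ≫ H.ev ≫ g = f ≫ g := by
  rw [← Category.assoc, psi_ev]

lemma hom_ext {X : C} {f g : X ⟶ H.obj} (h : f ⊵ₗ m ≫ H.ev = g ⊵ₗ m ≫ H.ev) : f = g := by
  rw [← homEquiv_eq, ← homEquiv_eq] at h
  exact (H.homEquiv X).injective h

/-- The morphism `Hom(f, g) : Hom(m, n) ⟶ Hom(m', n')`. -/
def map {m' n' : M} (H : InternalHom C m n) (H' : InternalHom C m' n') (f : m' ⟶ m)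
    (g : n ⟶ n') : H.obj ⟶ H'.obj :=
  H'.psi (H.obj ⊴ₗ f ≫ H.ev ≫ g)

lemma map_ev {m' n' : M} (H : InternalHom C m n) (H' : InternalHom C m' n') (f : m' ⟶ m)
    (g : n ⟶ n') : H.map H' f g ⊵ₗ m' ≫ H'.ev = H.obj ⊴ₗ f ≫ H.ev ≫ g :=
  H'.psi_ev _

@[simp]
lemma psi_homEquiv {X : C} (f : X ⟶ H.obj) : H.psi (H.homEquiv X f) = f :=
  Equiv.symm_apply_apply _ _

lemma psi_map {m' n' : M} (H : InternalHom C m n) (H' : InternalHom C m' n') {X : C}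
    (f : X ⊙ₗ m ⟶ n) (g : m' ⟶ m) (h : n ⟶ n') :
    H.psi f ≫ H.map H' g h = H'.psi (X ⊴ₗ g ≫ f ≫ h) := by
  apply InternalHom.hom_ext
  rw [comp_actionHomLeft, Category.assoc, InternalHom.map_ev, ← action_exchange_assoc,
    InternalHom.psi_ev_assoc, InternalHom.psi_ev]

lemma psi_injective {X : C} {f g : X ⊙ₗ m ⟶ n} : H.psi f = H.psi g ↔ f = g :=
  (H.homEquiv X).symm.injective.eq_iff

lemma comp_psi {X Y : C} (h : X ⟶ Y) (f : Y ⊙ₗ m ⟶ n) : h ≫ H.psi f = H.psi (h ⊵ₗ m ≫ f) := by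
  apply InternalHom.hom_ext
  rw [comp_actionHomLeft, Category.assoc, psi_ev, psi_ev]

lemma map_id : H.map H (𝟙 m) (𝟙 n) = 𝟙 H.obj := by
  apply hom_ext
  simp [map]

lemma map_comp {m' n' m'' n'' : M} (H : InternalHom C m n) (H' : InternalHom C m' n')
    (H'' : InternalHom C m'' n'') (f : m' ⟶ m) (g : n ⟶ n') (f' : m'' ⟶ m') (g' : n' ⟶ n'') :
    H.map H' f g ≫ H'.map H'' f' g' = H.map H'' (f' ≫ f) (g ≫ g') := by
  apply hom_ext
  rw [comp_actionHomLeft, Category.assoc, map_ev, map_ev, ← action_exchange_assoc,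
    ← Category.assoc (_ ⊵ₗ _), map_ev, actionHomRight_comp]
  simp only [Category.assoc]

end InternalHom

variable (H : ∀ m n : M, InternalHom C m n)

/-- The functor `Hom(-, T(-)) : Mᵒᵖ ⥤ M ⥤ C`, for chosen internal Homs `H` and `T : M ⥤ M`. -/
abbrev uhom (T : M ⥤ M) : Mᵒᵖ ⥤ M ⥤ C where
  obj m :=
    { obj := fun n => (H m.unop (T.obj n)).obj
      map := fun {n n'} g => (H m.unop (T.obj n)).map (H m.unop (T.obj n')) (𝟙 _) (T.map g)
      map_id := fun n => by rw [T.map_id, InternalHom.map_id]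
      map_comp := fun f g => by rw [InternalHom.map_comp, Category.comp_id, T.map_comp] }
  map {m m'} f :=
    { app := fun n => (H m.unop (T.obj n)).map (H m'.unop (T.obj n)) f.unop (𝟙 _)
      naturality := fun n n' g => by
        simp only [InternalHom.map_comp, Category.comp_id, Category.id_comp] }
  map_id m := by
    ext n
    exact InternalHom.map_id _
  map_comp {m m' m''} f g := by
    ext n
    refine Eq.trans ?_ (InternalHom.map_comp _ _ _ _ _ _ _).symm
    change (H _ _).map (H _ _) _ (𝟙 (T.obj n)) = (H _ _).map (H _ _) _ (𝟙 (T.obj n) ≫ 𝟙 (T.obj n))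
    rw [unop_comp, Category.comp_id (𝟙 (T.obj n))]

end InternalHom

/-! ### Relative ends -/

section RelativeEnd

variable {V : Type u₁} [Category.{v₁} V] [MonoidalCategory V] [RightRigidCategory V]
  {C : Type u₂} [Category.{v₂} C] [MonoidalCategory C]
  (G : V ⥤ Center C) [G.Monoidal]
  {M : Type u₃} [Category.{v₃} M] [MonoidalLeftAction C M]
  {A : Type u₂} [Category.{v₂} A]

/-- For a functor `S : Mᵒᵖ × M ⥤ A` with a prebalancing
`β^U_{m,n} : S(m, U ▶ n) ⟶ S(U^* ▶ m, n)`: an object with dinatural morphisms to `S(m, m)`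
such that `S(ev_U ▶ m, m) π_m = β^U_{U ▶ m, m} π_{U ▶ m}` (the associativity isomorphism
`(U^* ⊗ U) ▶ m ≅ U^* ▶ (U ▶ m)` is part of `vEv`). -/
structure RelEndCone (S : Mᵒᵖ ⥤ M ⥤ A)
    (β : ∀ (U : V) (m n : M),
      (S.obj (op m)).obj (vObj G U n) ⟶ (S.obj (op (vObj G Uᘁ m))).obj n) where
  pt : A
  π (m : M) : pt ⟶ (S.obj (op m)).obj m
  dinatural {m n : M} (f : m ⟶ n) :
    π m ≫ (S.obj (op m)).map f = π n ≫ (S.map f.op).app n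
  balanced (U : V) (m : M) :
    π m ≫ (S.map (vEv G U m).op).app m = π (vObj G U m) ≫ β U (vObj G U m) m

/-- A relative end of `(S, β)`: a universal `RelEndCone`. -/
structure RelEnd (S : Mᵒᵖ ⥤ M ⥤ A)
    (β : ∀ (U : V) (m n : M),
      (S.obj (op m)).obj (vObj G U n) ⟶ (S.obj (op (vObj G Uᘁ m))).obj n)
    extends RelEndCone G S β where
  existsUnique_lift (c : RelEndCone G S β) : ∃! h : c.pt ⟶ pt, ∀ m, c.π m = h ≫ π m

namespace RelEnd

variable {G} {S : Mᵒᵖ ⥤ M ⥤ A} {β : ∀ (U : V) (m n : M),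
      (S.obj (op m)).obj (vObj G U n) ⟶ (S.obj (op (vObj G Uᘁ m))).obj n} (E : RelEnd G S β)

/-- The morphism to a relative end given by its universal property. -/
def lift (c : RelEndCone G S β) : c.pt ⟶ E.pt := (E.existsUnique_lift c).choose

lemma lift_π (c : RelEndCone G S β) (m : M) : E.lift c ≫ E.π m = c.π m :=
  ((E.existsUnique_lift c).choose_spec.1 m).symm

lemma hom_ext {X : A} {f g : X ⟶ E.pt} (h : ∀ m, f ≫ E.π m = g ≫ E.π m) : f = g := by
  let c : RelEndCone G S β :=
    { pt := X
      π := fun m => g ≫ E.π m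
      dinatural := fun f => by simp only [Category.assoc, E.dinatural f]
      balanced := fun U m => by simp only [Category.assoc, E.balanced U m] }
  exact (E.existsUnique_lift c).unique (fun m => (h m).symm) (fun m => rfl)

end RelEnd

end RelativeEnd

/-! ### The functor `ρ̄` and the adjunction `ρ ⊣ ρ̄` -/

section RhoBar

open MonoidalLeftAction VEnd

variable {k : Type w} [Field k]
  {V : Type u₁} [Category.{v₁} V] [MonoidalCategory V] [RightRigidCategory V]
  {C : Type u₂} [Category.{v₂} C] [MonoidalCategory C]
  {G : V ⥤ Center C} [G.Monoidal]
  {M : Type u₃} [Category.{v₃} M] [Preadditive M] [Linear k M] [MonoidalLeftAction C M]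

/-- `γ^X_{U,m,n} : Hom_M(X ▷ m, F(U ▶ n)) → Hom_M(X ▷ (U^* ▶ m), F(n))`,
`γ(f) = (ev_U ▶ F(n)) (U^* ▶ d_{U,n} f) (σ_{G(U^*),X}⁻¹ ▷ m)`. -/
def gam (F : VEnd k G M) (X : C) (U : V) (m n : M) (f : X ⊙ₗ m ⟶ F.functor.obj (vObj G U n)) :
    X ⊙ₗ vObj G Uᘁ m ⟶ F.functor.obj n :=
  (vSwap G X Uᘁ m).hom ≫ (und G).obj Uᘁ ⊴ₗ (f ≫ (F.d U n).hom) ≫ vEv G U (F.functor.obj n)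

lemma gam_comp (F : VEnd k G M) {X Y : C} (h : X ⟶ Y) (U : V) (m n : M)
    (f : Y ⊙ₗ m ⟶ F.functor.obj (vObj G U n)) :
    gam F X U m n (h ⊵ₗ m ≫ f) = h ⊵ₗ vObj G Uᘁ m ≫ gam F Y U m n f := by
  simp only [gam, Category.assoc, actionHomRight_comp, ← reassoc_of% vSwap_nat_left G h]

lemma balanced_iff (F : VEnd k G M) (X : C) (θ : ∀ m, X ⊙ₗ m ⟶ F.functor.obj m) (U : V) (m : M) :
    X ⊴ₗ vEv G U m ≫ θ m = gam F X U (vObj G U m) m (θ (vObj G U m)) ↔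
      θ (vObj G U m) ≫ (F.d U m).hom = (vSwap G X U m).hom ≫ (und G).obj U ⊴ₗ θ m := by
  rw [vSwap_vEv, Category.assoc, Category.assoc, gam, ← vEv_nat, cancel_epi,
    ← actionHomRight_comp_assoc]
  exact ⟨fun h => (vEv_injective G U h).symm, fun h => by rw [h]⟩

variable (H : ∀ m n : M, InternalHom C m n)

/-- The prebalancing `β^U_{m,n} : Hom(m, F(U ▶ n)) ⟶ Hom(U^* ▶ m, F(n))`, that is
`β = ψ(γ(φ(id)))`. -/
def beta (F : VEnd k G M) (U : V) (m n : M) :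
    (H m (F.functor.obj (vObj G U n))).obj ⟶ (H (vObj G Uᘁ m) (F.functor.obj n)).obj :=
  (H (vObj G Uᘁ m) (F.functor.obj n)).psi
    (gam F _ U m n (H m (F.functor.obj (vObj G U n))).ev)

lemma gam_psi (F : VEnd k G M) {X : C} (U : V) (m n : M)
    (f : X ⊙ₗ m ⟶ F.functor.obj (vObj G U n)) :
    (H m (F.functor.obj (vObj G U n))).psi f ≫ beta H F U m n =
      (H (vObj G Uᘁ m) (F.functor.obj n)).psi (gam F X U m n f) := by
  apply InternalHom.hom_ext
  rw [comp_actionHomLeft, Category.assoc, beta, InternalHom.psi_ev, ← gam_comp,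
    InternalHom.psi_ev, InternalHom.psi_ev]

lemma cone_dinatural_iff (F : VEnd k G M) {X : C} (θ : ∀ m, X ⊙ₗ m ⟶ F.functor.obj m) {m n : M}
    (f : m ⟶ n) :
    (H m (F.functor.obj m)).psi (θ m) ≫ (H m _).map (H m _) (𝟙 _) (F.functor.map f) =
      (H n (F.functor.obj n)).psi (θ n) ≫ (H n _).map (H m _) f (𝟙 _) ↔
      X ⊴ₗ f ≫ θ n = θ m ≫ F.functor.map f := by
  rw [InternalHom.psi_map, InternalHom.psi_map, InternalHom.psi_injective, actionHomRight_id, Category.id_comp, Category.comp_id,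
    eq_comm]

lemma cone_balanced_iff (F : VEnd k G M) {X : C} (θ : ∀ m, X ⊙ₗ m ⟶ F.functor.obj m)
    (U : V) (m : M) :
    (H m (F.functor.obj m)).psi (θ m) ≫ (H m _).map (H _ _) (vEv G U m) (𝟙 _) =
      (H (vObj G U m) (F.functor.obj (vObj G U m))).psi (θ (vObj G U m)) ≫
        beta H F U (vObj G U m) m ↔
      θ (vObj G U m) ≫ (F.d U m).hom = (vSwap G X U m).hom ≫ (und G).obj U ⊴ₗ θ m := by
  rw [gam_psi, ← balanced_iff, InternalHom.psi_map, InternalHom.psi_injective, Category.comp_id]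

lemma cone_dinatural_iff' (F : VEnd k G M) {X : C}
    (ξ : ∀ m, X ⟶ (H m (F.functor.obj m)).obj) {m n : M} (f : m ⟶ n) :
    ξ m ≫ (H m _).map (H m _) (𝟙 _) (F.functor.map f) = ξ n ≫ (H n _).map (H m _) f (𝟙 _) ↔
      X ⊴ₗ f ≫ (H n _).homEquiv _ (ξ n) = (H m _).homEquiv _ (ξ m) ≫ F.functor.map f := by
  simpa only [InternalHom.psi_homEquiv] using
    cone_dinatural_iff H F (fun m => (H m _).homEquiv _ (ξ m)) f

lemma cone_balanced_iff' (F : VEnd k G M) {X : C}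
    (ξ : ∀ m, X ⟶ (H m (F.functor.obj m)).obj) (U : V) (m : M) :
    ξ m ≫ (H m _).map (H _ _) (vEv G U m) (𝟙 _) = ξ (vObj G U m) ≫ beta H F U (vObj G U m) m ↔
      (H _ _).homEquiv _ (ξ (vObj G U m)) ≫ (F.d U m).hom =
        (vSwap G X U m).hom ≫ (und G).obj U ⊴ₗ (H _ _).homEquiv _ (ξ m) := by
  simpa only [InternalHom.psi_homEquiv] using
    cone_balanced_iff H F (fun m => (H m _).homEquiv _ (ξ m)) U m

lemma coneMap_aux {X : C} {m n n' : M} (ξ : X ⟶ (H m n).obj) (f : n ⟶ n') :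
    ξ ≫ (H m n).map (H m n') (𝟙 m) f = (H m n').psi ((H m n).homEquiv _ ξ ≫ f) := by
  have h := (H m n).psi_map (H m n') ((H m n).homEquiv _ ξ) (𝟙 m) f
  rw [InternalHom.psi_homEquiv, actionHomRight_id, Category.id_comp] at h
  exact h

variable [Preadditive C] [Linear k C] [IsModuleCategory k C M]

/-- The cone `ψ(θ_m) : X ⟶ Hom(m, F(m))` given by a natural module transformation
`θ : ρ(X) ⟶ F`. -/
abbrev coneOfHom {X : C} {F : VEnd k G M} (θ : (rho k G M).obj X ⟶ F) :
    RelEndCone G (uhom H F.functor) (beta H F) where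
  pt := X
  π m := (H m (F.functor.obj m)).psi (θ.app m)
  dinatural f := (cone_dinatural_iff H F θ.app f).2 (θ.naturality f)
  balanced U m := (cone_balanced_iff H F θ.app U m).2 (θ.comm U m)

variable (E : ∀ F : VEnd k G M, RelEnd G (uhom H F.functor) (beta H F))

/-- The natural module transformation `ρ(X) ⟶ F` with components `φ(ξ_m)` given by a cone
`ξ_m : X ⟶ Hom(m, F(m))`. -/
abbrev homOfCone {F : VEnd k G M} (c : RelEndCone G (uhom H F.functor) (beta H F)) :
    (rho k G M).obj c.pt ⟶ F where
  app m := (H m (F.functor.obj m)).homEquiv _ (c.π m)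
  naturality f := (cone_dinatural_iff' H F c.π f).1 (c.dinatural f)
  comm U m := (cone_balanced_iff' H F c.π U m).1 (c.balanced U m)

/-- The cone `Hom(m, α_m) ξ_m` given by a cone `ξ` and a natural module transformation `α`. -/
abbrev coneMap {F F' : VEnd k G M} (c : RelEndCone G (uhom H F.functor) (beta H F)) (α : F ⟶ F') :
    RelEndCone G (uhom H F'.functor) (beta H F') where
  pt := c.pt
  π m := c.π m ≫ (H m (F.functor.obj m)).map (H m (F'.functor.obj m)) (𝟙 m) (α.app m)
  dinatural {m n} f := by
    rw [coneMap_aux H (c.π m) (α.app m), coneMap_aux H (c.π n) (α.app n)]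
    exact (coneOfHom H (homOfCone H c ≫ α)).dinatural f
  balanced U m := by
    rw [coneMap_aux H (c.π m) (α.app m), coneMap_aux H (c.π (vObj G U m)) (α.app (vObj G U m))]
    exact (coneOfHom H (homOfCone H c ≫ α)).balanced U m

variable (E : ∀ F : VEnd k G M, RelEnd G (uhom H F.functor) (beta H F))

/-- `ρ̄ : End_V(M) ⥤ C`, `ρ̄(F, d) = ∮ (Hom(m, F(m)), β)`; on morphisms, `ρ̄(α)` is the unique
morphism with `λ_m ρ̄(α) = Hom(m, α_m) λ_m`. -/
def rhoBar : VEnd k G M ⥤ C where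
  obj F := (E F).pt
  map {F F'} α := (E F').lift (coneMap H (E F).toRelEndCone α)
  map_id F := by
    refine (E F).hom_ext fun m => ?_
    rw [RelEnd.lift_π, Category.id_comp]
    change (E F).π m ≫ (H m _).map (H m _) (𝟙 m) (𝟙 _) = _
    rw [InternalHom.map_id, Category.comp_id]
  map_comp {F F' F''} α α' := by
    refine (E F'').hom_ext fun m => ?_
    rw [RelEnd.lift_π, Category.assoc, RelEnd.lift_π]
    change (E F).π m ≫ (H m _).map (H m _) (𝟙 m) (α.app m ≫ α'.app m) =
      (E F').lift (coneMap H (E F).toRelEndCone α) ≫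
        (E F').π m ≫ (H m _).map (H m _) (𝟙 m) (α'.app m)
    have h := (E F').lift_π (coneMap H (E F).toRelEndCone α) m
    rw [reassoc_of% h, InternalHom.map_comp, Category.comp_id]

lemma rhoBar_map_π {F F' : VEnd k G M} (α : F ⟶ F') (m : M) :
    (rhoBar H E).map α ≫ (E F').π m =
      (E F).π m ≫ (H m (F.functor.obj m)).map (H m (F'.functor.obj m)) (𝟙 m) (α.app m) :=
  (E F').lift_π (coneMap H (E F).toRelEndCone α) m

/-- The bijection `Hom(ρ(X), F) ≃ Hom(X, ρ̄(F))`, which sends `θ` to the morphism induced by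
`ψ(θ_m)`. -/
def rhoHomEquiv (X : C) (F : VEnd k G M) : ((rho k G M).obj X ⟶ F) ≃ (X ⟶ (E F).pt) where
  toFun θ := (E F).lift (coneOfHom H θ)
  invFun f := (rho k G M).map f ≫ homOfCone H (E F).toRelEndCone
  left_inv θ := by
    ext m
    change (E F).lift (coneOfHom H θ) ⊵ₗ m ≫ (H m _).homEquiv _ ((E F).π m) = θ.app m
    rw [← InternalHom.homEquiv_naturality, RelEnd.lift_π]
    exact Equiv.apply_symm_apply _ _
  right_inv f := by
    refine (E F).hom_ext fun m => ?_
    rw [RelEnd.lift_π]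
    change (H m _).psi (f ⊵ₗ m ≫ (H m _).homEquiv _ ((E F).π m)) = _
    rw [← InternalHom.comp_psi, InternalHom.psi_homEquiv]

/-- The adjunction `ρ ⊣ ρ̄`. -/
def rhoAdj : rho k G M ⊣ rhoBar H E :=
  Adjunction.mkOfHomEquiv
    { homEquiv := rhoHomEquiv H E
      homEquiv_naturality_left_symm := fun {X Y F} f g => by
        have h := (rho k G M).map_comp f g
        exact (congrArg (· ≫ homOfCone H (E F).toRelEndCone) h).trans (Category.assoc _ _ _)
      homEquiv_naturality_right := fun {X F F'} θ α => by
        refine (E F').hom_ext fun m => ?_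
        refine ((E F').lift_π (coneOfHom H (θ ≫ α)) m).trans ?_
        refine Eq.trans ?_ (Category.assoc _ _ _).symm
        refine Eq.trans ?_ (congrArg (_ ≫ ·) (rhoBar_map_π H E α m)).symm
        refine Eq.trans ?_ (Category.assoc _ _ _)
        refine Eq.trans ?_ (congrArg (· ≫ _) ((E F).lift_π (coneOfHom H θ) m)).symm
        refine Eq.trans ?_ (InternalHom.psi_map _ _ _ _ _).symm
        rw [actionHomRight_id, Category.id_comp]
        rfl }

lemma rhoAdj_counit_app (F : VEnd k G M) (m : M) :
    ((rhoAdj H E).counit.app F).app m = (H m (F.functor.obj m)).homEquiv _ ((E F).π m) := by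
  have h : (rhoAdj H E).counit.app F = homOfCone H (E F).toRelEndCone := by
    have h₁ : (rhoAdj H E).counit.app F = (rhoHomEquiv H E _ F).symm (𝟙 _) := by
      simp [rhoAdj]
      rfl
    exact h₁.trans ((congrArg (· ≫ homOfCone H (E F).toRelEndCone)
      ((rho k G M).map_id _)).trans (Category.id_comp _))
  rw [h]

lemma rhoAdj_unit_app (X : C) (m : M) :
    (rhoAdj H E).unit.app X ≫ (E ((rho k G M).obj X)).π m =
      (H m (X ⊙ₗ m)).psi (𝟙 (X ⊙ₗ m)) := by
  have h : (rhoAdj H E).unit.app X = rhoHomEquiv H E X _ (𝟙 _) := by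
    simp [rhoAdj]
    rfl
  rw [h]
  exact (E ((rho k G M).obj X)).lift_π _ m

end RhoBar

/-! ### Adjoints of module functors -/

section ModuleAdjoint

variable {C : Type u₁} [Category.{v₁} C] [MonoidalCategory C]
  {D : Type u₂} [Category.{v₂} D] {D' : Type u₃} [Category.{v₃} D']
  {L : D ⥤ D'} {R : D' ⥤ D} (adj : L ⊣ R)

lemma adj_hom_ext (adj : L ⊣ R) {c : D} {n : D'} {f g : c ⟶ R.obj n}
    (h : L.map f ≫ adj.counit.app n = L.map g ≫ adj.counit.app n) : f = g := by
  apply (adj.homEquiv c n).symm.injective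
  simpa only [Adjunction.homEquiv_counit] using h

section Left

open MonoidalLeftAction Functor.LaxLeftLinear Functor.OplaxLeftLinear

variable [MonoidalLeftAction C D] [MonoidalLeftAction C D'] [L.LeftLinear C]

/-- `R(X ▷ ε_n) R(c_{X,R(n)}) η_{X ▷ R(n)} : X ▷ R(n) ⟶ R(X ▷ n)`, where `c` is the module
structure of `L`. -/
def adjμₗ (X : C) (n : D') : X ⊙ₗ R.obj n ⟶ R.obj (X ⊙ₗ n) :=
  adj.unit.app (X ⊙ₗ R.obj n) ≫ R.map (δₗ L X (R.obj n)) ≫ R.map (X ⊴ₗ adj.counit.app n)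

lemma adjμₗ_counit (X : C) (n : D') : L.map (adjμₗ adj X n) ≫ adj.counit.app (X ⊙ₗ n) =
    δₗ L X (R.obj n) ≫ X ⊴ₗ adj.counit.app n := by
  simp [adjμₗ]

lemma adjμₗ_counit_assoc (X : C) (n : D') {p : D'} (h : X ⊙ₗ n ⟶ p) :
    L.map (adjμₗ adj X n) ≫ adj.counit.app (X ⊙ₗ n) ≫ h =
      δₗ L X (R.obj n) ≫ X ⊴ₗ adj.counit.app n ≫ h := by
  rw [← Category.assoc, adjμₗ_counit, Category.assoc]

/-- The right adjoint of a module functor is a lax module functor. -/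
abbrev adjLaxLeftLinear : R.LaxLeftLinear C where
  μₗ := adjμₗ adj
  μₗ_naturality_left f n := by
    apply adj_hom_ext adj
    simp [adjμₗ_counit, adjμₗ_counit_assoc, action_exchange]
  μₗ_naturality_right X n n' f := by
    apply adj_hom_ext adj
    simp [adjμₗ_counit, adjμₗ_counit_assoc, ← actionHomRight_comp]
  μₗ_associativity X Y n := by
    apply adj_hom_ext adj
    simp [adjμₗ_counit, adjμₗ_counit_assoc]
    simp [← actionHomRight_comp, adjμₗ_counit]
  μₗ_unitality n := by
    apply adj_hom_ext adj
    simp [adjμₗ_counit_assoc]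

section

variable [RightRigidCategory C] (R) [R.LaxLeftLinear C]

/-- The inverse of the structure morphism of a lax module functor. -/
def laxδₗ (X : C) (n : D') : R.obj (X ⊙ₗ n) ⟶ X ⊙ₗ R.obj n :=
  (λₗ (R.obj (X ⊙ₗ n))).inv ≫ η_ X Xᘁ ⊵ₗ _ ≫ (αₗ _ _ _).hom ≫
    X ⊴ₗ (μₗ R Xᘁ (X ⊙ₗ n) ≫ R.map (actEv (ε_ X Xᘁ) n))

lemma μₗ_actEv {X Y : C} (e : Y ⊗ X ⟶ 𝟙_ C) (n : D') :
    Y ⊴ₗ μₗ R X n ≫ μₗ R Y (X ⊙ₗ n) ≫ R.map (actEv e n) = actEv e (R.obj n) := by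
  have h := μₗ_associativity_inv R Y X n
  simp only [actEv, Functor.map_comp]
  rw [reassoc_of% h, ← μₗ_naturality_left_assoc, ← μₗ_unitality]

lemma μₗ_laxδₗ (X : C) (n : D') : μₗ R X n ≫ laxδₗ R X n = 𝟙 _ := by
  rw [laxδₗ, reassoc_of% act_coev_nat, ← actionHomRight_comp, μₗ_actEv,
    actEv_zigzag _ _ (ExactPairing.evaluation_coevaluation X Xᘁ), Iso.inv_hom_id]

lemma laxδₗ_μₗ (X : C) (n : D') : laxδₗ R X n ≫ μₗ R X n = 𝟙 _ := by
  have h := μₗ_associativity R X Xᘁ (X ⊙ₗ n)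
  simp only [laxδₗ, Category.assoc, actionHomRight_comp, μₗ_naturality_right]
  rw [← reassoc_of% h, μₗ_naturality_left_assoc, ← Functor.map_comp, ← Functor.map_comp,
    actEv_zigzag _ _ (ExactPairing.evaluation_coevaluation X Xᘁ), ← μₗ_unitality,
    Iso.inv_hom_id]

/-- A lax module functor is a module functor if the acting category is rigid. -/
abbrev leftLinearOfLax : R.LeftLinear C where
  δₗ := laxδₗ R
  δₗ_naturality_left {X Y} f n := by
    have : IsIso (μₗ R X n) := ⟨laxδₗ R X n, μₗ_laxδₗ R X n, laxδₗ_μₗ R X n⟩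
    rw [← cancel_epi (μₗ R X n), ← μₗ_naturality_left_assoc, μₗ_laxδₗ,
      ← Category.assoc (μₗ R X n), μₗ_laxδₗ, Category.comp_id, Category.id_comp]
  δₗ_naturality_right X {n n'} f := by
    have : IsIso (μₗ R X n) := ⟨laxδₗ R X n, μₗ_laxδₗ R X n, laxδₗ_μₗ R X n⟩
    rw [← cancel_epi (μₗ R X n), ← μₗ_naturality_right_assoc, μₗ_laxδₗ,
      ← Category.assoc (μₗ R X n), μₗ_laxδₗ, Category.comp_id, Category.id_comp]
  δₗ_associativity X Y n := by
    have h : IsIso (μₗ R (X ⊗ Y) n) := ⟨laxδₗ R _ n, μₗ_laxδₗ R _ n, laxδₗ_μₗ R _ n⟩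
    rw [← cancel_epi (μₗ R (X ⊗ Y) n), ← Category.assoc (μₗ R (X ⊗ Y) n), μₗ_laxδₗ,
      Category.id_comp, μₗ_associativity_assoc, ← Category.assoc (μₗ R X (Y ⊙ₗ n)), μₗ_laxδₗ,
      Category.id_comp, ← actionHomRight_comp, μₗ_laxδₗ, actionHomRight_id, Category.comp_id]
  δₗ_unitality_inv n := by
    rw [← μₗ_unitality_inv, Category.assoc, μₗ_laxδₗ, Category.comp_id]
  μₗ_comp_δₗ := μₗ_laxδₗ R
  δₗ_comp_μₗ := laxδₗ_μₗ R

end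

end Left

section Right

open MonoidalRightAction Functor.LaxRightLinear Functor.OplaxRightLinear

lemma assoc_inv_ract [MonoidalRightAction C D] (A B X : C) (m : D) : m ⊴ᵣ (α_ A B X).inv =
    (αᵣ m A (B ⊗ X)).hom ≫ (αᵣ (m ⊙ᵣ A) B X).hom ≫ (αᵣ m A B).inv ⊵ᵣ X ≫
      (αᵣ m (A ⊗ B) X).inv := by
  have h := actionHom_associator A B X m
  rw [← cancel_epi (m ⊴ᵣ (α_ A B X).hom), ← actionHomRight_comp, reassoc_of% h]
  simp

lemma leftUnitor_inv_ract [MonoidalRightAction C D] (X : C) (m : D) : m ⊴ᵣ (λ_ X).inv =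
    (ρᵣ m).inv ⊵ᵣ X ≫ (αᵣ m (𝟙_ C) X).inv := by
  rw [← cancel_epi (m ⊴ᵣ (λ_ X).hom), ← actionHomRight_comp, actionHom_leftUnitor]
  simp

variable [MonoidalRightAction C D] [MonoidalRightAction C D'] [L.RightLinear C]

/-- `R(ε_n ◁ X) R(d_{R(n),X}) η_{R(n) ◁ X} : R(n) ◁ X ⟶ R(n ◁ X)`, where `d` is the module
structure of `L`. -/
def adjμᵣ (n : D') (X : C) : R.obj n ⊙ᵣ X ⟶ R.obj (n ⊙ᵣ X) :=
  adj.unit.app (R.obj n ⊙ᵣ X) ≫ R.map (δᵣ L (R.obj n) X) ≫ R.map (adj.counit.app n ⊵ᵣ X)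

lemma adjμᵣ_counit (n : D') (X : C) : L.map (adjμᵣ adj n X) ≫ adj.counit.app (n ⊙ᵣ X) =
    δᵣ L (R.obj n) X ≫ adj.counit.app n ⊵ᵣ X := by
  simp [adjμᵣ]

lemma adjμᵣ_counit_assoc (n : D') (X : C) {p : D'} (h : n ⊙ᵣ X ⟶ p) :
    L.map (adjμᵣ adj n X) ≫ adj.counit.app (n ⊙ᵣ X) ≫ h =
      δᵣ L (R.obj n) X ≫ adj.counit.app n ⊵ᵣ X ≫ h := by
  rw [← Category.assoc, adjμᵣ_counit, Category.assoc]

/-- The right adjoint of a module functor is a lax module functor. -/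
abbrev adjLaxRightLinear : R.LaxRightLinear C where
  μᵣ := adjμᵣ adj
  μᵣ_naturality_right n X Y f := by
    apply adj_hom_ext adj
    simp [adjμᵣ_counit, adjμᵣ_counit_assoc, action_exchange]
  μᵣ_naturality_left f X := by
    apply adj_hom_ext adj
    simp [adjμᵣ_counit, adjμᵣ_counit_assoc, ← comp_actionHomLeft]
  μᵣ_associativity n X Y := by
    apply adj_hom_ext adj
    simp [adjμᵣ_counit, adjμᵣ_counit_assoc]
    simp [← comp_actionHomLeft, adjμᵣ_counit]
  μᵣ_unitality n := by
    apply adj_hom_ext adj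
    simp [adjμᵣ_counit_assoc]

/-- The morphism `(m ◁ X) ◁ Y ⟶ m` induced by `e : X ⊗ Y ⟶ 1`. -/
def ractEv {X Y : C} (e : X ⊗ Y ⟶ 𝟙_ C) (m : D) : (m ⊙ᵣ X) ⊙ᵣ Y ⟶ m :=
  (αᵣ m X Y).inv ≫ m ⊴ᵣ e ≫ (ρᵣ m).hom

lemma ractEv_zigzag {X Y : C} (e : X ⊗ Y ⟶ 𝟙_ C) (c : 𝟙_ C ⟶ Y ⊗ X)
    (h : X ◁ c ≫ (α_ X Y X).inv ≫ e ▷ X = (ρ_ X).hom ≫ (λ_ X).inv) (m : D) :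
    (m ⊙ᵣ X) ⊴ᵣ c ≫ (αᵣ (m ⊙ᵣ X) Y X).hom ≫ ractEv e m ⊵ᵣ X = (ρᵣ (m ⊙ᵣ X)).hom := by
  have h' := congrArg (fun t => m ⊴ᵣ t ≫ m ⊴ᵣ (λ_ X).hom) h
  simp only [actionHomRight_comp, Category.assoc, assoc_inv_ract, whiskerRight_actionHomLeft,
    actionHomRight_whiskerRight, actionHom_leftUnitor, actionHom_rightUnitor,
    leftUnitor_inv_ract, Iso.inv_hom_id_assoc] at h'
  replace h' := (cancel_epi _).1 h'
  simp only [← comp_actionHomLeft, Iso.inv_hom_id, id_actionHomLeft, Category.comp_id] at h'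
  exact h'

lemma ract_coev_nat {X Y : C} (c : 𝟙_ C ⟶ Y ⊗ X) {m n : D} (f : m ⟶ n) :
    f ≫ (ρᵣ n).inv ≫ n ⊴ᵣ c ≫ (αᵣ n Y X).hom =
      (ρᵣ m).inv ≫ m ⊴ᵣ c ≫ (αᵣ m Y X).hom ≫ (f ⊵ᵣ Y) ⊵ᵣ X := by
  rw [← cancel_mono (αᵣ n Y X).inv]
  simp only [Category.assoc, Iso.hom_inv_id, Category.comp_id]
  rw [← actionHomLeft_tensor, action_exchange, unit_actionHomRight]
  simp

section

variable [LeftRigidCategory C] (R) [R.LaxRightLinear C]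

/-- The inverse of the structure morphism of a lax module functor. -/
def laxδᵣ (n : D') (X : C) : R.obj (n ⊙ᵣ X) ⟶ R.obj n ⊙ᵣ X :=
  (ρᵣ (R.obj (n ⊙ᵣ X))).inv ≫ _ ⊴ᵣ η_ (HasLeftDual.leftDual X) X ≫ (αᵣ _ _ _).hom ≫
    (μᵣ R (n ⊙ᵣ X) (HasLeftDual.leftDual X) ≫ R.map (ractEv (ε_ (HasLeftDual.leftDual X) X) n)) ⊵ᵣ X

lemma μᵣ_ractEv {X Y : C} (e : X ⊗ Y ⟶ 𝟙_ C) (n : D') :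
    μᵣ R n X ⊵ᵣ Y ≫ μᵣ R (n ⊙ᵣ X) Y ≫ R.map (ractEv e n) = ractEv e (R.obj n) := by
  have h := μᵣ_associativity_inv R n X Y
  simp only [ractEv, Functor.map_comp]
  rw [reassoc_of% h, ← μᵣ_naturality_right_assoc, ← μᵣ_unitality]

lemma μᵣ_laxδᵣ (n : D') (X : C) : μᵣ R n X ≫ laxδᵣ R n X = 𝟙 _ := by
  rw [laxδᵣ, reassoc_of% ract_coev_nat, ← comp_actionHomLeft, μᵣ_ractEv,
    ractEv_zigzag _ _ (ExactPairing.coevaluation_evaluation (HasLeftDual.leftDual X) X), Iso.inv_hom_id]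

lemma laxδᵣ_μᵣ (n : D') (X : C) : laxδᵣ R n X ≫ μᵣ R n X = 𝟙 _ := by
  have h := μᵣ_associativity R (n ⊙ᵣ X) (HasLeftDual.leftDual X) X
  simp only [laxδᵣ, Category.assoc, comp_actionHomLeft, μᵣ_naturality_left]
  rw [← reassoc_of% h, μᵣ_naturality_right_assoc, ← Functor.map_comp, ← Functor.map_comp,
    ractEv_zigzag _ _ (ExactPairing.coevaluation_evaluation (HasLeftDual.leftDual X) X), ← μᵣ_unitality,
    Iso.inv_hom_id]

/-- A lax module functor is a module functor if the acting category is rigid. -/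
abbrev rightLinearOfLax : R.RightLinear C where
  δᵣ := laxδᵣ R
  δᵣ_naturality_right n {X Y} f := by
    have : IsIso (μᵣ R n X) := ⟨laxδᵣ R n X, μᵣ_laxδᵣ R n X, laxδᵣ_μᵣ R n X⟩
    rw [← cancel_epi (μᵣ R n X), ← μᵣ_naturality_right_assoc, μᵣ_laxδᵣ,
      ← Category.assoc (μᵣ R n X), μᵣ_laxδᵣ, Category.comp_id, Category.id_comp]
  δᵣ_naturality_left {n n'} f X := by
    have : IsIso (μᵣ R n X) := ⟨laxδᵣ R n X, μᵣ_laxδᵣ R n X, laxδᵣ_μᵣ R n X⟩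
    rw [← cancel_epi (μᵣ R n X), ← μᵣ_naturality_left_assoc, μᵣ_laxδᵣ,
      ← Category.assoc (μᵣ R n X), μᵣ_laxδᵣ, Category.comp_id, Category.id_comp]
  δᵣ_associativity n X Y := by
    have h : IsIso (μᵣ R n (X ⊗ Y)) := ⟨laxδᵣ R n _, μᵣ_laxδᵣ R n _, laxδᵣ_μᵣ R n _⟩
    rw [← cancel_epi (μᵣ R n (X ⊗ Y)), ← Category.assoc (μᵣ R n (X ⊗ Y)), μᵣ_laxδᵣ,
      Category.id_comp, μᵣ_associativity_assoc, ← Category.assoc (μᵣ R (n ⊙ᵣ X) Y), μᵣ_laxδᵣ,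
      Category.id_comp, ← comp_actionHomLeft, μᵣ_laxδᵣ, id_actionHomLeft, Category.comp_id]
  δᵣ_unitality_inv n := by
    rw [← μᵣ_unitality_inv, Category.assoc, μᵣ_laxδᵣ, Category.comp_id]
  μᵣ_comp_δᵣ := μᵣ_laxδᵣ R
  δᵣ_comp_μᵣ := laxδᵣ_μᵣ R

end

end Right

end ModuleAdjoint
/-! ### Bimodule categories and the relative center -/

section Bimodule

open MonoidalLeftAction Functor.LaxLeftLinear Functor.OplaxLeftLinear
  Functor.LaxRightLinear Functor.OplaxRightLinear

/-- A `C`-bimodule category: left and right actions of `C` with coherent natural isomorphisms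
`γ_{X,n,Y} : (X ▷ n) ◁ Y ≅ X ▷ (n ◁ Y)`. -/
class BimoduleCategory (C : Type u₁) [Category.{v₁} C] [MonoidalCategory C]
    (N : Type u₂) [Category.{v₂} N] [MonoidalLeftAction C N] [MonoidalRightAction C N] where
  mid (X : C) (n : N) (Y : C) : (X ⊙ₗ n) ⊙ᵣ Y ≅ X ⊙ₗ (n ⊙ᵣ Y)
  mid_nat_left {X X' : C} (f : X ⟶ X') (n : N) (Y : C) :
    (f ⊵ₗ n) ⊵ᵣ Y ≫ (mid X' n Y).hom = (mid X n Y).hom ≫ f ⊵ₗ (n ⊙ᵣ Y)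
  mid_nat_mid (X : C) {n n' : N} (f : n ⟶ n') (Y : C) :
    (X ⊴ₗ f) ⊵ᵣ Y ≫ (mid X n' Y).hom = (mid X n Y).hom ≫ X ⊴ₗ (f ⊵ᵣ Y)
  mid_nat_right (X : C) (n : N) {Y Y' : C} (f : Y ⟶ Y') :
    (X ⊙ₗ n) ⊴ᵣ f ≫ (mid X n Y').hom = (mid X n Y).hom ≫ X ⊴ₗ (n ⊴ᵣ f)
  mid_tensor_left (X X' : C) (n : N) (Y : C) :
    (mid (X ⊗ X') n Y).hom ≫ (αₗ X X' (n ⊙ᵣ Y)).hom =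
      (αₗ X X' n).hom ⊵ᵣ Y ≫ (mid X (X' ⊙ₗ n) Y).hom ≫ X ⊴ₗ (mid X' n Y).hom
  mid_tensor_right (X : C) (n : N) (Y Y' : C) :
    (mid X n (Y ⊗ Y')).hom ≫ X ⊴ₗ (αᵣ n Y Y').hom =
      (αᵣ (X ⊙ₗ n) Y Y').hom ≫ (mid X n Y).hom ⊵ᵣ Y' ≫ (mid X (n ⊙ᵣ Y) Y').hom
  mid_unit_left (n : N) (Y : C) :
    (mid (𝟙_ C) n Y).hom ≫ (λₗ (n ⊙ᵣ Y)).hom = (λₗ n).hom ⊵ᵣ Y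
  mid_unit_right (X : C) (n : N) :
    (mid X n (𝟙_ C)).hom ≫ X ⊴ₗ (ρᵣ n).hom = (ρᵣ (X ⊙ₗ n)).hom

open BimoduleCategory (mid)

/-- The regular bimodule category. -/
instance (C : Type u₁) [Category.{v₁} C] [MonoidalCategory C] : BimoduleCategory C C where
  mid X n Y := α_ X n Y
  mid_nat_left f n Y := associator_naturality_left f n Y
  mid_nat_mid X _ _ f Y := associator_naturality_middle X f Y
  mid_nat_right X n _ _ f := associator_naturality_right X n f
  mid_tensor_left X X' n Y := (pentagon X X' n Y).symm
  mid_tensor_right X n Y Y' := by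
    change (α_ X n (Y ⊗ Y')).hom ≫ X ◁ (α_ n Y Y').inv =
      (α_ (X ⊗ n) Y Y').inv ≫ (α_ X n Y).hom ▷ Y' ≫ (α_ X (n ⊗ Y) Y').hom
    simp
  mid_unit_left n Y := by
    change (α_ (𝟙_ C) n Y).hom ≫ (λ_ (n ⊗ Y)).hom = (λ_ n).hom ▷ Y
    simp
  mid_unit_right X n := by
    change (α_ X n (𝟙_ C)).hom ≫ X ◁ (ρ_ n).hom = (ρ_ (X ⊗ n)).hom
    simp

variable {C : Type u₁} [Category.{v₁} C] [MonoidalCategory C]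
  {N : Type u₂} [Category.{v₂} N] [MonoidalLeftAction C N] [MonoidalRightAction C N]
  [BimoduleCategory C N]
  {N' : Type u₃} [Category.{v₃} N'] [MonoidalLeftAction C N'] [MonoidalRightAction C N']
  [BimoduleCategory C N']

variable (C) in
/-- The compatibility of the left and right module structures of a bimodule functor. -/
class IsBimoduleFunctor (F : N ⥤ N') [F.LeftLinear C] [F.RightLinear C] : Prop where
  compat (X : C) (n : N) (Y : C) :
    δᵣ F (X ⊙ₗ n) Y ≫ δₗ F X n ⊵ᵣ Y ≫ (mid X (F.obj n) Y).hom =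
      F.map (mid X n Y).hom ≫ δₗ F X (n ⊙ᵣ Y) ≫ X ⊴ₗ δᵣ F n Y

lemma IsBimoduleFunctor.compat' (F : N ⥤ N') [F.LeftLinear C] [F.RightLinear C]
    [IsBimoduleFunctor C F] (X : C) (n : N) (Y : C) :
    δₗ F X n ⊵ᵣ Y ≫ (mid X (F.obj n) Y).hom ≫ X ⊴ₗ μᵣ F n Y =
      μᵣ F (X ⊙ₗ n) Y ≫ F.map (mid X n Y).hom ≫ δₗ F X (n ⊙ᵣ Y) := by
  have : IsIso (δᵣ F (X ⊙ₗ n) Y) := inferInstance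
  rw [← cancel_epi (δᵣ F (X ⊙ₗ n) Y), reassoc_of% IsBimoduleFunctor.compat X n Y]
  simp [← actionHomRight_comp]

lemma isBimoduleFunctor_of_lax (F : N ⥤ N') [F.LeftLinear C] [F.RightLinear C]
    (h : ∀ (X : C) (n : N) (Y : C), μₗ F X n ⊵ᵣ Y ≫ μᵣ F (X ⊙ₗ n) Y ≫ F.map (mid X n Y).hom =
      (mid X (F.obj n) Y).hom ≫ X ⊴ₗ μᵣ F n Y ≫ μₗ F X (n ⊙ᵣ Y)) : IsBimoduleFunctor C F where
  compat X n Y := by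
    have h₁ : X ⊴ₗ μᵣ F n Y ≫ μₗ F X (n ⊙ᵣ Y) ≫ δₗ F X (n ⊙ᵣ Y) ≫ X ⊴ₗ δᵣ F n Y = 𝟙 _ := by
      rw [Functor.LeftLinear.μₗ_comp_δₗ_assoc, ← actionHomRight_comp,
        Functor.RightLinear.μᵣ_comp_δᵣ, actionHomRight_id]
    have h₂ : δₗ F X n ⊵ᵣ Y ≫ μₗ F X n ⊵ᵣ Y = 𝟙 _ := by
      rw [← MonoidalRightAction.comp_actionHomLeft, Functor.LeftLinear.δₗ_comp_μₗ,
        MonoidalRightAction.id_actionHomLeft]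
    rw [← Category.comp_id (mid X (F.obj n) Y).hom, ← h₁, ← reassoc_of% h X n Y,
      reassoc_of% h₂, Functor.RightLinear.δᵣ_comp_μᵣ_assoc]

/-- The right adjoint of a bimodule functor over a rigid category is a bimodule functor. -/
lemma isBimoduleFunctor_adj {L : N ⥤ N'} {R : N' ⥤ N} (adj : L ⊣ R) [L.LeftLinear C]
    [L.RightLinear C] [IsBimoduleFunctor C L] [RigidCategory C] :
    letI := adjLaxLeftLinear (C := C) adj
    letI := adjLaxRightLinear (C := C) adj
    letI := leftLinearOfLax (C := C) R
    letI := rightLinearOfLax (C := C) R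
    IsBimoduleFunctor C R := by
  let := adjLaxLeftLinear (C := C) adj
  let := adjLaxRightLinear (C := C) adj
  let := leftLinearOfLax (C := C) R
  let := rightLinearOfLax (C := C) R
  apply isBimoduleFunctor_of_lax
  intro X n Y
  apply adj_hom_ext adj
  change L.map (adjμₗ adj X n ⊵ᵣ Y ≫ adjμᵣ adj (X ⊙ₗ n) Y ≫ R.map (mid X n Y).hom) ≫ _ =
    L.map ((mid X (R.obj n) Y).hom ≫ X ⊴ₗ adjμᵣ adj n Y ≫ adjμₗ adj X (n ⊙ᵣ Y)) ≫ _
  have h₁ : L.map (adjμₗ adj X n ⊵ᵣ Y) ≫ δᵣ L (R.obj (X ⊙ₗ n)) Y =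
      δᵣ L (X ⊙ₗ R.obj n) Y ≫ L.map (adjμₗ adj X n) ⊵ᵣ Y := δᵣ_naturality_left _ _ _
  have h₂ : L.map (X ⊴ₗ adjμᵣ adj n Y) ≫ δₗ L X (R.obj (n ⊙ᵣ Y)) =
      δₗ L X (R.obj n ⊙ᵣ Y) ≫ X ⊴ₗ L.map (adjμᵣ adj n Y) := δₗ_naturality_right _ _ _
  have h₃ : L.map (R.map (mid X n Y).hom) ≫ adj.counit.app (X ⊙ₗ n ⊙ᵣ Y) =
      adj.counit.app ((X ⊙ₗ n) ⊙ᵣ Y) ≫ (mid X n Y).hom := adj.counit_naturality _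
  have h₄ : (X ⊴ₗ adj.counit.app n) ⊵ᵣ Y ≫ (mid X n Y).hom =
      (mid X (L.obj (R.obj n)) Y).hom ≫ X ⊴ₗ (adj.counit.app n ⊵ᵣ Y) :=
    BimoduleCategory.mid_nat_mid X _ Y
  simp only [Functor.map_comp, Category.assoc, adjμₗ_counit]
  rw [h₃, adjμᵣ_counit_assoc, reassoc_of% h₁, reassoc_of% h₂, ← actionHomRight_comp, adjμᵣ_counit,
    ← MonoidalRightAction.comp_actionHomLeft_assoc, adjμₗ_counit, actionHomRight_comp,
    ← reassoc_of% IsBimoduleFunctor.compat (C := C) (F := L),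
    MonoidalRightAction.comp_actionHomLeft_assoc, h₄]

variable (C N) in
/-- The relative center `Z_C(N)` of a `C`-bimodule category: pairs `(n, σ)` with a half-braiding
`σ_X : n ◁ X ≅ X ▷ n`. -/
structure RelCenter where
  obj : N
  hb (X : C) : obj ⊙ᵣ X ≅ X ⊙ₗ obj
  naturality {X Y : C} (f : X ⟶ Y) : obj ⊴ᵣ f ≫ (hb Y).hom = (hb X).hom ≫ f ⊵ₗ obj
  monoidal (X Y : C) : (hb (X ⊗ Y)).hom ≫ (αₗ X Y obj).hom =
    (αᵣ obj X Y).hom ≫ (hb X).hom ⊵ᵣ Y ≫ (mid X obj Y).hom ≫ X ⊴ₗ (hb Y).hom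

namespace RelCenter

/-- Morphisms in the relative center: morphisms compatible with the half-braidings. -/
@[ext]
structure Hom (A B : RelCenter C N) where
  hom : A.obj ⟶ B.obj
  comm (X : C) : hom ⊵ᵣ X ≫ (B.hb X).hom = (A.hb X).hom ≫ X ⊴ₗ hom

instance : Category (RelCenter C N) where
  Hom A B := Hom A B
  id A := { hom := 𝟙 _, comm := by simp }
  comp f g :=
    { hom := f.hom ≫ g.hom
      comm := fun X => by
        rw [MonoidalRightAction.comp_actionHomLeft, Category.assoc, g.comm, ← Category.assoc,
          f.comm, Category.assoc, actionHomRight_comp] }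
  id_comp f := Hom.ext (Category.id_comp _)
  comp_id f := Hom.ext (Category.comp_id _)
  assoc f g h := Hom.ext (Category.assoc _ _ _)

@[ext]
lemma hom_ext {A B : RelCenter C N} {f g : A ⟶ B} (h : f.hom = g.hom) : f = g := Hom.ext h

@[simp] lemma id_hom (A : RelCenter C N) : Hom.hom (𝟙 A) = 𝟙 A.obj := rfl

@[simp] lemma comp_hom {A B D : RelCenter C N} (f : A ⟶ B) (g : B ⟶ D) :
    (f ≫ g).hom = f.hom ≫ g.hom := rfl

section

variable (F : N ⥤ N') [F.LeftLinear C] [F.RightLinear C]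

/-- The isomorphism `c F(σ_X) d⁻¹ : F(n) ◁ X ≅ X ▷ F(n)`. -/
def mapHb (A : RelCenter C N) (X : C) : F.obj A.obj ⊙ᵣ X ≅ X ⊙ₗ F.obj A.obj where
  hom := μᵣ F A.obj X ≫ F.map (A.hb X).hom ≫ δₗ F X A.obj
  inv := μₗ F X A.obj ≫ F.map (A.hb X).inv ≫ δᵣ F A.obj X
  hom_inv_id := by
    rw [Category.assoc, Category.assoc, Functor.LeftLinear.δₗ_comp_μₗ_assoc,
      ← F.map_comp_assoc, Iso.hom_inv_id, F.map_id, Category.id_comp,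
      Functor.RightLinear.μᵣ_comp_δᵣ]
  inv_hom_id := by
    rw [Category.assoc, Category.assoc, Functor.RightLinear.δᵣ_comp_μᵣ_assoc,
      ← F.map_comp_assoc, Iso.inv_hom_id, F.map_id, Category.id_comp,
      Functor.LeftLinear.μₗ_comp_δₗ]

lemma mapHb_naturality (A : RelCenter C N) {X Y : C} (f : X ⟶ Y) :
    F.obj A.obj ⊴ᵣ f ≫ (mapHb F A Y).hom = (mapHb F A X).hom ≫ f ⊵ₗ F.obj A.obj := by
  rw [mapHb, mapHb, μᵣ_naturality_right_assoc, ← F.map_comp_assoc, A.naturality, Category.assoc,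
    Category.assoc, F.map_comp_assoc, δₗ_naturality_left]

lemma mapHb_comm {A B : RelCenter C N} (f : A ⟶ B) (X : C) :
    F.map f.hom ⊵ᵣ X ≫ (mapHb F B X).hom = (mapHb F A X).hom ≫ X ⊴ₗ F.map f.hom := by
  rw [mapHb, mapHb, μᵣ_naturality_left_assoc, ← F.map_comp_assoc, f.comm, Category.assoc,
    Category.assoc, F.map_comp_assoc, δₗ_naturality_right]

lemma mapHb_monoidal [IsBimoduleFunctor C F] (A : RelCenter C N) (X Y : C) :
    (mapHb F A (X ⊗ Y)).hom ≫ (αₗ X Y (F.obj A.obj)).hom =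
      (αᵣ (F.obj A.obj) X Y).hom ≫ (mapHb F A X).hom ⊵ᵣ Y ≫ (mid X (F.obj A.obj) Y).hom ≫
        X ⊴ₗ (mapHb F A Y).hom := by
  simp only [mapHb, Category.assoc, MonoidalRightAction.comp_actionHomLeft, actionHomRight_comp,
    reassoc_of% IsBimoduleFunctor.compat' F X A.obj Y, δₗ_associativity,
    μᵣ_naturality_left_assoc]
  rw [← δₗ_naturality_right_assoc, ← μᵣ_associativity_assoc]
  simp only [← Functor.map_comp_assoc, A.monoidal]

variable (C) in
/-- The functor `Z_C(F) : Z_C(N) ⥤ Z_C(N')`, `(n, σ) ↦ (F(n), c F(σ) d⁻¹)`, induced by a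
bimodule functor `(F, c, d)`. -/
def map [IsBimoduleFunctor C F] : RelCenter C N ⥤ RelCenter C N' where
  obj A :=
    { obj := F.obj A.obj
      hb := mapHb F A
      naturality := mapHb_naturality F A
      monoidal := mapHb_monoidal F A }
  map f :=
    { hom := F.map f.hom
      comm := mapHb_comm F f }
  map_id A := hom_ext (F.map_id A.obj)
  map_comp f g := hom_ext (F.map_comp f.hom g.hom)

end

/-- The half-braiding `n ⊗ X ≅ X ⊗ n` of an object of the relative center of `C`. -/
def selfHb (A : RelCenter C C) (X : C) : A.obj ⊗ X ≅ X ⊗ A.obj := A.hb X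

lemma selfHb_monoidal (A : RelCenter C C) (X Y : C) : (selfHb A (X ⊗ Y)).hom =
    (α_ _ _ _).inv ≫ (selfHb A X).hom ▷ Y ≫ (α_ _ _ _).hom ≫ X ◁ (selfHb A Y).hom ≫
      (α_ _ _ _).inv := by
  have h : (selfHb A (X ⊗ Y)).hom ≫ (α_ X Y A.obj).hom = (α_ A.obj X Y).inv ≫
      (selfHb A X).hom ▷ Y ≫ (α_ X A.obj Y).hom ≫ X ◁ (selfHb A Y).hom := A.monoidal X Y
  rw [← cancel_mono (α_ X Y A.obj).hom, h]
  simp only [Category.assoc, Iso.inv_hom_id, Category.comp_id]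

/-- The identification of the relative center of the regular bimodule category with the
Drinfeld center. -/
def toCenter : RelCenter C C ⥤ Center C where
  obj A := ⟨A.obj,
    { β := selfHb A
      monoidal := selfHb_monoidal A
      naturality := fun f => A.naturality f }⟩
  map f := { f := f.hom, comm := f.comm }
  map_id _ := rfl
  map_comp _ _ := rfl

end RelCenter

end Bimodule

/-! ### `ρ` and `ρ̄` as bimodule functors -/

section RhoBimodule

open MonoidalLeftAction VEnd

variable {k : Type w} [Field k]
  {V : Type u₁} [Category.{v₁} V] [MonoidalCategory V]
  {C : Type u₂} [Category.{v₂} C] [MonoidalCategory C]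
  {G : V ⥤ Center C} [G.Monoidal]
  {M : Type u₃} [Category.{v₃} M] [Preadditive M] [Linear k M] [MonoidalLeftAction C M]
  [Preadditive C] [Linear k C] [IsModuleCategory k C M]

instance : BimoduleCategory C (VEnd k G M) where
  mid := midAssoc
  mid_nat_left f F Y := by
    ext m
    exact (Category.comp_id _).trans (Category.id_comp _).symm
  mid_nat_mid X _ _ f Y := by
    ext m
    exact (Category.comp_id _).trans (Category.id_comp _).symm
  mid_nat_right X F _ _ f := by
    ext m
    exact (Category.comp_id _).trans (Category.id_comp _).symm
  mid_tensor_left X X' F Y := by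
    ext m
    change 𝟙 _ ≫ (αₗ X X' (F.functor.obj (Y ⊙ₗ m))).hom =
      (αₗ X X' (F.functor.obj (Y ⊙ₗ m))).hom ≫ 𝟙 _ ≫ X ⊴ₗ 𝟙 _
    simp
  mid_tensor_right X F Y Y' := by
    ext m
    change 𝟙 _ ≫ X ⊴ₗ F.functor.map (αₗ Y Y' m).hom =
      X ⊴ₗ F.functor.map (αₗ Y Y' m).hom ≫ 𝟙 _ ≫ 𝟙 _
    simp
  mid_unit_left F Y := by
    ext m
    exact Category.id_comp _
  mid_unit_right X F := by
    ext m
    exact Category.id_comp _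

instance : (rho k G M).LeftLinear C where
  μₗ X Y := (rhoLeft X Y).inv
  δₗ X Y := (rhoLeft X Y).hom
  μₗ_comp_δₗ X Y := (rhoLeft X Y).inv_hom_id
  δₗ_comp_μₗ X Y := (rhoLeft X Y).hom_inv_id
  μₗ_naturality_left {X X'} f Y := by
    ext m
    change f ⊵ₗ (Y ⊙ₗ m) ≫ (αₗ X' Y m).inv = (αₗ X Y m).inv ≫ (f ▷ Y) ⊵ₗ m
    simp
  μₗ_naturality_right X {Y Y'} f := by
    ext m
    change X ⊴ₗ f ⊵ₗ m ≫ (αₗ X Y' m).inv = (αₗ X Y m).inv ≫ (X ◁ f) ⊵ₗ m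
    simp
  μₗ_associativity X Y Z := by
    ext m
    change (αₗ (X ⊗ Y) Z m).inv ≫ (α_ X Y Z).hom ⊵ₗ m =
      (αₗ X Y (Z ⊙ₗ m)).hom ≫ X ⊴ₗ (αₗ Y Z m).inv ≫ (αₗ X (Y ⊗ Z) m).inv
    simp [assoc_hom_act]
  μₗ_unitality X := by
    ext m
    change (λₗ (X ⊙ₗ m)).hom = (αₗ (𝟙_ C) X m).inv ≫ (λ_ X).hom ⊵ₗ m
    simp
  δₗ_naturality_left {X X'} f Y := by
    ext m
    change (f ▷ Y) ⊵ₗ m ≫ (αₗ X' Y m).hom = (αₗ X Y m).hom ≫ f ⊵ₗ (Y ⊙ₗ m)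
    simp
  δₗ_naturality_right X {Y Y'} f := by
    ext m
    change (X ◁ f) ⊵ₗ m ≫ (αₗ X Y' m).hom = (αₗ X Y m).hom ≫ X ⊴ₗ f ⊵ₗ m
    simp
  δₗ_associativity X Y Z := by
    ext m
    change (αₗ (X ⊗ Y) Z m).hom ≫ (αₗ X Y (Z ⊙ₗ m)).hom =
      (α_ X Y Z).hom ⊵ₗ m ≫ (αₗ X (Y ⊗ Z) m).hom ≫ X ⊴ₗ (αₗ Y Z m).hom
    simp
  δₗ_unitality_inv X := by
    ext m
    change (λₗ (X ⊙ₗ m)).inv = (λ_ X).inv ⊵ₗ m ≫ (αₗ (𝟙_ C) X m).hom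
    simp [leftUnitor_inv_act]

instance : (rho k G M).RightLinear C where
  μᵣ X Y := (rhoRight X Y).inv
  δᵣ X Y := (rhoRight X Y).hom
  μᵣ_comp_δᵣ X Y := (rhoRight X Y).inv_hom_id
  δᵣ_comp_μᵣ X Y := (rhoRight X Y).hom_inv_id
  μᵣ_naturality_right X {Y Y'} f := by
    ext m
    change X ⊴ₗ f ⊵ₗ m ≫ (αₗ X Y' m).inv = (αₗ X Y m).inv ≫ (X ◁ f) ⊵ₗ m
    simp
  μᵣ_naturality_left {X X'} f Y := by
    ext m
    change f ⊵ₗ (Y ⊙ₗ m) ≫ (αₗ X' Y m).inv = (αₗ X Y m).inv ≫ (f ▷ Y) ⊵ₗ m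
    simp
  μᵣ_associativity X Y Z := by
    ext m
    change (αₗ X (Y ⊗ Z) m).inv ≫ (α_ X Y Z).inv ⊵ₗ m =
      X ⊴ₗ (αₗ Y Z m).hom ≫ (αₗ X Y (Z ⊙ₗ m)).inv ≫ (αₗ (X ⊗ Y) Z m).inv
    simp [assoc_inv_act]
  μᵣ_unitality X := by
    ext m
    change X ⊴ₗ (λₗ m).hom = (αₗ X (𝟙_ C) m).inv ≫ (ρ_ X).hom ⊵ₗ m
    simp
  δᵣ_naturality_right X {Y Y'} f := by
    ext m
    change (X ◁ f) ⊵ₗ m ≫ (αₗ X Y' m).hom = (αₗ X Y m).hom ≫ X ⊴ₗ f ⊵ₗ m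
    simp
  δᵣ_naturality_left {X X'} f Y := by
    ext m
    change (f ▷ Y) ⊵ₗ m ≫ (αₗ X' Y m).hom = (αₗ X Y m).hom ≫ f ⊵ₗ (Y ⊙ₗ m)
    simp
  δᵣ_associativity X Y Z := by
    ext m
    change (αₗ X (Y ⊗ Z) m).hom ≫ X ⊴ₗ (αₗ Y Z m).hom =
      (α_ X Y Z).inv ⊵ₗ m ≫ (αₗ (X ⊗ Y) Z m).hom ≫ (αₗ X Y (Z ⊙ₗ m)).hom
    simp [assoc_inv_act]
  δᵣ_unitality_inv X := by
    ext m
    change X ⊴ₗ (λₗ m).inv = (ρ_ X).inv ⊵ₗ m ≫ (αₗ X (𝟙_ C) m).hom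
    simp [rightUnitor_inv_act]

instance : IsBimoduleFunctor C (rho k G M) where
  compat X Y Z := by
    ext m
    change (αₗ (X ⊗ Y) Z m).hom ≫ (αₗ X Y (Z ⊙ₗ m)).hom ≫ 𝟙 _ =
      (α_ X Y Z).hom ⊵ₗ m ≫ (αₗ X (Y ⊗ Z) m).hom ≫ X ⊴ₗ (αₗ Y Z m).hom
    simp

variable [RightRigidCategory V] [RigidCategory C] (H : ∀ m n : M, InternalHom C m n)
  (E : ∀ F : VEnd k G M, RelEnd G (uhom H F.functor) (beta H F))

instance : (rhoBar H E).LaxLeftLinear C := adjLaxLeftLinear (rhoAdj H E)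

instance : (rhoBar H E).LaxRightLinear C := adjLaxRightLinear (rhoAdj H E)

/-- The left module structure of `ρ̄`, as the right adjoint of `ρ`. -/
instance : (rhoBar H E).LeftLinear C := leftLinearOfLax (rhoBar H E)

/-- The right module structure of `ρ̄`, as the right adjoint of `ρ`. -/
instance : (rhoBar H E).RightLinear C := rightLinearOfLax (rhoBar H E)

instance : IsBimoduleFunctor C (rhoBar H E) := isBimoduleFunctor_adj (rhoAdj H E)

/-- The functor `Z_C(ρ̄) : Z_C(End_V(M)) ⥤ Z(C)`. -/
def centerRhoBar : RelCenter C (VEnd k G M) ⥤ Center C :=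
  RelCenter.map C (rhoBar H E) ⋙ RelCenter.toCenter

end RhoBimodule

/-! ### The subcategory `C(V, M)`, the dual category and the relative center `Z^V(C)` -/

section MainCategories

open MonoidalLeftAction VEnd Functor.LaxLeftLinear Functor.OplaxLeftLinear

variable (k : Type w) [Field k]
  {V : Type u₁} [Category.{v₁} V] [MonoidalCategory V]
  {C : Type u₂} [Category.{v₂} C] [MonoidalCategory C]
  (G : V ⥤ Center C) [G.Monoidal]
  (M : Type u₃) [Category.{v₃} M] [Preadditive M] [Linear k M] [MonoidalLeftAction C M]

section

variable [Preadditive C] [Linear k C] [IsModuleCategory k C M]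

/-- The condition `c_{G(U), m} = d_{U, m}` on an object `(F, c, d)` of `Z_C(End_V(M))`. -/
def isRestricted : ObjectProperty (RelCenter C (VEnd k G M)) := fun A =>
  ∀ (U : V) (m : M), (A.hb ((und G).obj U)).hom.app m = (A.obj.d U m).hom

/-- The full subcategory `C(V, M)` of `Z_C(End_V(M))`. -/
abbrev CentralEnd := (isRestricted k G M).FullSubcategory

end

/-- The condition `σ_{G(U), A} σ_{A, G(U)} = id` on an object `(A, σ)` of `Z(C)`. -/
def isCentralizing : ObjectProperty (Center C) := fun A =>
  ∀ U : V, (β_ A (G.obj U)).hom ≫ (β_ (G.obj U) A).hom = 𝟙 (A ⊗ G.obj U)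

/-- The relative center `Z^V(C)`: the full subcategory of `Z(C)` of the objects that centralize
`G(V)`. -/
abbrev CentralizerCat := (isCentralizing G).FullSubcategory

variable (C) in
/-- The objects of the dual category `C^*_M = End_C(M)`: `k`-linear functors `F : M ⥤ M` with a
structure `c_{X,m} : F(X ▷ m) ≅ X ▷ F(m)` of a `C`-module functor (`c` is `δₗ`). -/
structure DualCat where
  functor : M ⥤ M
  additive : functor.Additive
  linear : functor.Linear k
  leftLinear : functor.LeftLinear C

namespace DualCat

attribute [instance] DualCat.additive DualCat.linear DualCat.leftLinear

variable {k M}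

/-- Natural module transformations between `C`-module functors. -/
@[ext]
structure Hom (F F' : DualCat k C M) where
  app (m : M) : F.functor.obj m ⟶ F'.functor.obj m
  naturality {m n : M} (f : m ⟶ n) : F.functor.map f ≫ app n = app m ≫ F'.functor.map f
  comm (X : C) (m : M) :
    app (X ⊙ₗ m) ≫ δₗ F'.functor X m = δₗ F.functor X m ≫ X ⊴ₗ app m

instance : Category (DualCat k C M) where
  Hom F F' := Hom F F'
  id F := { app := fun m => 𝟙 _, naturality := by simp, comm := by simp }
  comp α β :=
    { app := fun m => α.app m ≫ β.app m
      naturality := by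
        intro m n f
        rw [← Category.assoc, α.naturality, Category.assoc, β.naturality, Category.assoc]
      comm := by
        intro X m
        rw [Category.assoc, β.comm, ← Category.assoc, α.comm, Category.assoc,
          actionHomRight_comp] }
  id_comp α := by ext; exact Category.id_comp _
  comp_id α := by ext; exact Category.comp_id _
  assoc α β γ := by ext; exact Category.assoc _ _ _

section

variable (F : DualCat k C M)

/-- The isomorphism `c_{X,m} : F(X ▷ m) ≅ X ▷ F(m)`. -/
def c (X : C) (m : M) : F.functor.obj (X ⊙ₗ m) ≅ X ⊙ₗ F.functor.obj m :=
  (Functor.LeftLinear.μₗIso F.functor X m).symm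

lemma c_nat (X : C) {m n : M} (f : m ⟶ n) :
    F.functor.map (X ⊴ₗ f) ≫ (F.c X n).hom = (F.c X m).hom ≫ X ⊴ₗ F.functor.map f :=
  δₗ_naturality_right F.functor X f

lemma c_nat_left {X Y : C} (f : X ⟶ Y) (m : M) :
    F.functor.map (f ⊵ₗ m) ≫ (F.c Y m).hom = (F.c X m).hom ≫ f ⊵ₗ F.functor.obj m :=
  δₗ_naturality_left F.functor f m

lemma c_tensor (X Y : C) (m : M) :
    (F.c (X ⊗ Y) m).hom ≫ (αₗ X Y (F.functor.obj m)).hom =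
      F.functor.map (αₗ X Y m).hom ≫ (F.c X (Y ⊙ₗ m)).hom ≫ X ⊴ₗ (F.c Y m).hom :=
  δₗ_associativity F.functor X Y m

lemma c_tensor_inv (X Y : C) (m : M) :
    F.functor.map (αₗ X Y m).inv ≫ (F.c (X ⊗ Y) m).hom =
      (F.c X (Y ⊙ₗ m)).hom ≫ X ⊴ₗ (F.c Y m).hom ≫ (αₗ X Y (F.functor.obj m)).inv := by
  rw [← cancel_epi (F.functor.map (αₗ X Y m).hom), ← cancel_mono (αₗ X Y (F.functor.obj m)).hom]
  simp only [Category.assoc, Iso.inv_hom_id, Category.comp_id, c_tensor,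
    ← F.functor.map_comp_assoc, Iso.inv_hom_id_assoc, Iso.hom_inv_id, F.functor.map_id,
    Category.id_comp, ← Functor.map_comp]

lemma c_unit (m : M) :
    (F.c (𝟙_ C) m).hom ≫ (λₗ (F.functor.obj m)).hom = F.functor.map (λₗ m).hom := by
  have h : F.functor.map (λₗ m).inv ≫ (F.c (𝟙_ C) m).hom = (λₗ (F.functor.obj m)).inv :=
    (δₗ_unitality_inv F.functor m).symm
  rw [← cancel_epi (F.functor.map (λₗ m).inv), reassoc_of% h, Iso.inv_hom_id,
    ← F.functor.map_comp, Iso.inv_hom_id, F.functor.map_id]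

lemma c_swap (U : V) (X : C) (m : M) :
    (F.c X (vObj G U m)).hom ≫ X ⊴ₗ (F.c ((und G).obj U) m).hom ≫
        (vSwap G X U (F.functor.obj m)).hom =
      F.functor.map (vSwap G X U m).hom ≫ (F.c ((und G).obj U) (X ⊙ₗ m)).hom ≫
        (und G).obj U ⊴ₗ (F.c X m).hom := by
  change _ ≫ _ ≫ (αₗ _ _ _).inv ≫ _ ⊵ₗ _ ≫ (αₗ _ _ _).hom =
    F.functor.map ((αₗ _ _ _).inv ≫ _ ⊵ₗ _ ≫ (αₗ _ _ _).hom) ≫ _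
  rw [← reassoc_of% F.c_tensor_inv, ← reassoc_of% F.c_nat_left, c_tensor]
  simp only [Functor.map_comp, Category.assoc]

/-- The restriction `c|_V` of the module structure: the `V`-module functor `(F, c|_V)` with
`(c|_V)_{U,m} = c_{G(U),m}`. -/
@[simps]
def restrict : VEnd k G M where
  functor := F.functor
  additive := F.additive
  linear := F.linear
  d U m := F.c ((und G).obj U) m
  d_nat U _ _ f := F.c_nat _ f
  d_nat_left g m := F.c_nat_left _ m
  d_tensor U W m := by
    change _ ≫ _ ⊵ₗ _ ≫ (αₗ _ _ _).hom = F.functor.map (_ ⊵ₗ _ ≫ (αₗ _ _ _).hom) ≫ _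
    rw [← reassoc_of% F.c_nat_left, F.functor.map_comp_assoc, c_tensor]
  d_unit m := by
    change _ ≫ _ ⊵ₗ _ ≫ (λₗ _).hom = F.functor.map (_ ⊵ₗ _ ≫ (λₗ _).hom)
    rw [← reassoc_of% F.c_nat_left, F.functor.map_comp, c_unit]

variable [Preadditive C] [Linear k C] [IsModuleCategory k C M]

/-- The half-braiding `c_X : F ◁ X ≅ X ▷ F` with components `c_{X,m}`. -/
def hbIso (X : C) : (F.restrict G) ⊙ᵣ X ≅ X ⊙ₗ (F.restrict G) :=
  isoMk (F := ract (F.restrict G) X) (F' := lact X (F.restrict G)) (fun m => F.c X m)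
    (fun f => F.c_nat X f) (fun U m => by
      refine (F.c_swap G U X m).trans ?_
      exact (Category.assoc _ _ _).symm)

/-- The object `(F, c, c|_V)` of `Z_C(End_V(M))`. -/
def toRelCenter : RelCenter C (VEnd k G M) where
  obj := F.restrict G
  hb := F.hbIso G
  naturality f := by
    ext m
    exact F.c_nat_left f m
  monoidal X Y := by
    ext m
    change (F.c (X ⊗ Y) m).hom ≫ (αₗ X Y (F.functor.obj m)).hom =
      F.functor.map (αₗ X Y m).hom ≫ (F.c X (Y ⊙ₗ m)).hom ≫ 𝟙 _ ≫ X ⊴ₗ (F.c Y m).hom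
    rw [c_tensor, Category.id_comp]

end

variable (k M) [Preadditive C] [Linear k C] [IsModuleCategory k C M]

/-- The functor `H : C^*_M ⥤ C(V, M)`, `H(F, c) = (F, c, c|_V)`. -/
def toCentralEnd : DualCat k C M ⥤ CentralEnd k G M :=
  (isRestricted k G M).lift
    { obj := fun F => F.toRelCenter G
      map := fun {F F'} α =>
        { hom :=
            { app := α.app
              naturality := α.naturality
              comm := fun U m => α.comm _ m }
          comm := fun X => by
            ext m
            exact α.comm X m } }
    (fun _ _ _ => rfl)

end DualCat

end MainCategories

/-! ### Finite categories -/

section Finite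

/-- A finite `k`-linear abelian category: finite-dimensional morphism spaces, all objects of
finite length, enough projectives, finitely many simple objects up to isomorphism. -/
class IsFiniteLinear (k : Type w) [Field k] (A : Type u₁) [Category.{v₁} A] [Abelian A]
    [Linear k A] : Prop where
  finite_hom (X Y : A) : FiniteDimensional k (X ⟶ Y)
  noetherian (X : A) : IsNoetherianObject X
  artinian (X : A) : IsArtinianObject X
  enoughProjectives : EnoughProjectives A
  finite_simple : ∃ (n : ℕ) (S : Fin n → A), ∀ X : A, Simple X → ∃ i, Nonempty (X ≅ S i)

/-- A finite tensor category over `k`: a finite `k`-linear abelian rigid monoidal category with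
`k`-bilinear tensor product and simple unit object. -/
class IsFiniteTensor (k : Type w) [Field k] (A : Type u₁) [Category.{v₁} A] [Abelian A]
    [Linear k A] [MonoidalCategory A] [RigidCategory A] : Prop extends IsFiniteLinear k A,
    MonoidalPreadditive A where
  linear : MonoidalLinear k A
  simple_unit : Simple (𝟙_ A)

end Finite

end CentralHopf
end
open CentralHopf

universe w v₁ v₂ v₃ u₁ u₂ u₃

namespace CentralHopf

/-! ### Projective generators and representability over finite categories -/

section Representability

attribute [local instance] Abelian.hasFiniteBiproducts

variable {k : Type w} [Field k]

/-! Three independent arguments are involved.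

Trivial double braiding. The half-braiding of `ρ̄(F)` with `X` is obtained from `ρ̄(c_X)` by
composing with the right module structure of `ρ̄` and the inverse of its left one. For `X = G(U)`
the claim is that it equals `σ⁻¹`, where `σ` is the half-braiding of `G(U)`. Both module structures
of `ρ̄` come from the adjunction `ρ ⊣ ρ̄`, so the claim can be tested after transposition, where it
becomes an equation between transformations with target `G(U) ▷ F`. That equation says that the
counit `ρ(ρ̄(F)) ⟶ F` respects the `V`-module structures: the structure on `ρ(ρ̄(F))` is by
definition `σ⁻¹`, and the structure `d` on `F` may be replaced by `c` because the two agree on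
`G(V)`. Since every morphism of `End_V(M)`, the counit included, respects these structures, no
computation with ends is needed. This is `adjμᵣ_comp_eq_comp_adjμₗ` and `mapHb_rhoBar`. The functors
to `Z^V(C)` then exist because it is a full subcategory.

The equivalence. In `C(V, M)` the structure `d` is determined by `c`, and the half-braiding axioms
for `c` are, component by component, the axioms of a `C`-module functor. The exception is the unit
axiom, which is recovered from the one for `d` in `RelCenter.hbApp_unit`. Morphisms on both sides
are families of components subject to the same conditions.

Existence. Internal Homs and relative ends are representing objects, and both are produced by
`exists_representing_of_descent`. Given a right exact functor `T` with finite-dimensional spaces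
`Hom(T X, n)`, a family of subspaces closed under precomposition and under descent along
epimorphisms is represented by a quotient of a power of a projective generator. All of `Hom(X ▷ m,
n)` gives the internal Hom. For the relative end, cones with apex `X` correspond to module
transformations `ρ(X) ⟶ F`. By `rho_hom_ext` these embed into `Hom(X ▷ Q, F(Q))` for a generator `Q`
of `M`, and `exists_rho_hom_desc` supplies the descent. -/

lemma projective_biproduct {A : Type u₁} [Category.{v₁} A] [Abelian A] {a : ℕ} (P : Fin a → A)
    [∀ i, Projective (P i)] : Projective (⨁ P) where
  factors f e _ := ⟨biproduct.desc fun i => Projective.factorThru (biproduct.ι P i ≫ f) e, by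
    apply biproduct.hom_ext'
    intro i
    simp⟩

/-- A finite category has a projective object of which every object is a quotient of a power. -/
lemma IsFiniteLinear.exists_generator (k : Type w) [Field k] (A : Type u₁) [Category.{v₁} A]
    [Abelian A] [Linear k A] [IsFiniteLinear k A] :
    ∃ P : A, Projective P ∧
      ∀ X : A, ∃ (a : ℕ) (p : (⨁ fun _ : Fin a => P) ⟶ X), Epi p := by
  obtain ⟨n, S, hS⟩ := IsFiniteLinear.finite_simple (k := k) (A := A)
  have := IsFiniteLinear.enoughProjectives (k := k) (A := A)
  let P : A := ⨁ fun i => Projective.over (S i)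
  have hP : Projective P := projective_biproduct _
  refine ⟨P, hP, fun X => ?_⟩
  have := IsFiniteLinear.noetherian (k := k) X
  -- As `X` is noetherian, some map from a power of `P` has maximal image. The zero map from the
  -- empty power shows that there is something to choose from.
  obtain ⟨N, ⟨a, p, rfl⟩, hmax⟩ := (wellFounded_gt (α := Subobject X)).has_min
    {N | ∃ (a : ℕ) (p : (⨁ fun _ : Fin a => P) ⟶ X), N = imageSubobject p}
    ⟨_, 0, 0, rfl⟩
  refine ⟨a, p, ?_⟩
  by_contra hp
  -- If `p` were not epi, its nonzero cokernel, being artinian, would contain a simple subobject.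
  -- The object `P` maps onto that, and projectivity lifts the map to `l : P ⟶ X`, whose image is
  -- not contained in that of `p`.
  have hc : ¬ IsZero (cokernel p) := fun h =>
    hp (Preadditive.epi_of_cokernel_zero (h.eq_of_tgt _ _))
  have := IsFiniteLinear.artinian (k := k) (cokernel p)
  obtain ⟨i, ⟨e⟩⟩ := hS (simpleSubobject hc) inferInstance
  let s : P ⟶ simpleSubobject hc := biproduct.π _ i ≫ Projective.π (S i) ≫ e.inv
  have hs : s ≫ simpleSubobjectArrow hc ≠ 0 := fun h => by
    have h' : s = 0 := (cancel_mono (simpleSubobjectArrow hc)).1 (by rw [h, zero_comp])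
    have : Epi s := inferInstance
    exact id_nonzero (simpleSubobject hc) ((cancel_epi s).1 (by simp [h']))
  let l : P ⟶ X := Projective.factorThru (s ≫ simpleSubobjectArrow hc) (cokernel.π p)
  have hl : l ≫ cokernel.π p ≠ 0 := by rwa [Projective.factorThru_comp]
  -- Adjoining `l` as summand `0` enlarges the image of `p`. By maximality the two images coincide,
  -- so `l` dies in the cokernel of `p`, contrary to its choice.
  let q : (⨁ fun _ : Fin (a + 1) => P) ⟶ X :=
    biproduct.desc (Fin.cons l fun j => biproduct.ι (fun _ : Fin a => P) j ≫ p)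
  have hpq : p = biproduct.desc (fun j : Fin a => biproduct.ι (fun _ => P) j.succ) ≫ q := by
    apply biproduct.hom_ext'
    intro j
    simp [q]
  have hlq : l = biproduct.ι (fun _ : Fin (a + 1) => P) 0 ≫ q := by simp [q]
  have hle : imageSubobject p ≤ imageSubobject q := by
    conv_lhs => rw [hpq]
    exact imageSubobject_comp_le _ _
  have hge : imageSubobject q ≤ imageSubobject p := by
    by_contra h
    exact hmax _ ⟨a + 1, q, rfl⟩ (lt_of_le_not_ge hle h)
  apply hl
  have hw : (imageSubobject p).arrow ≫ cokernel.π p = 0 := by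
    rw [← cancel_epi (factorThruImageSubobject p)]
    simp
  rw [hlq, ← imageSubobject_arrow_comp q, ← Subobject.ofLE_arrow hge]
  simp only [Category.assoc, hw, comp_zero]

/-! ### Representing families of subspaces of `Hom(T X, n)` -/

variable {C : Type u₂} [Category.{v₂} C] [Abelian C] [Linear k C] [IsFiniteLinear k C]
  {M : Type u₃} [Category.{v₃} M] [Preadditive M] [Linear k M]

/-- For an object `P` and a functor `T`, morphisms out of `T (P ^ a)` are determined by their
restrictions to the summands. -/
lemma map_biproduct_hom_ext {T : C ⥤ M} [T.Additive] {P : C} {a : ℕ} {n : M}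
    {f g : T.obj (⨁ fun _ : Fin a => P) ⟶ n}
    (h : ∀ j, T.map (biproduct.ι (fun _ : Fin a => P) j) ≫ f =
      T.map (biproduct.ι (fun _ : Fin a => P) j) ≫ g) : f = g := by
  have hid : ∑ j, T.map (biproduct.π (fun _ : Fin a => P) j) ≫
      T.map (biproduct.ι (fun _ : Fin a => P) j) = 𝟙 _ := by
    simp only [← T.map_comp, ← T.map_sum, biproduct.total, T.map_id]
  rw [← Category.id_comp f, ← Category.id_comp g, ← hid, Preadditive.sum_comp,
    Preadditive.sum_comp]
  simp only [Category.assoc, h]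

/-- Let `T` be a right exact functor on a finite category and `n` an object such that the spaces
`Hom(T X, n)` are finite-dimensional. A family of subspaces of these spaces that is stable under
precomposition and descends along epimorphisms is a representable functor. -/
theorem exists_representing_of_descent (T : C ⥤ M) [T.Additive] [T.Linear k]
    [PreservesFiniteColimits T] (n : M) (hfin : ∀ X, FiniteDimensional k (T.obj X ⟶ n))
    (Φ : ∀ X, Submodule k (T.obj X ⟶ n))
    (hpre : ∀ {X Y : C} (h : X ⟶ Y) (f : T.obj Y ⟶ n), f ∈ Φ Y → T.map h ≫ f ∈ Φ X)
    (hdesc : ∀ {X Y : C} (p : X ⟶ Y) [Epi p] (f : T.obj Y ⟶ n), T.map p ≫ f ∈ Φ X → f ∈ Φ Y) :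
    ∃ (Y : C) (y : T.obj Y ⟶ n), y ∈ Φ Y ∧
      ∀ (X : C) (f : T.obj X ⟶ n), f ∈ Φ X → ∃! h : X ⟶ Y, T.map h ≫ y = f := by
  obtain ⟨P, hP, hgen⟩ := IsFiniteLinear.exists_generator k C
  have hpro (a : ℕ) : Projective (⨁ fun _ : Fin a => P) := projective_biproduct _
  let r := Module.finrank k (Φ P)
  let b := Module.finBasis k (Φ P)
  -- The first approximation to the representing object: one copy of `P` for each vector of a basis
  -- of `Φ P`, with `z` assembled from these vectors. Every element of `Φ P` is then a pullback of
  -- `z` along a linear combination of the inclusions, and the same follows for powers of `P`. The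
  -- pullback need not be unique, which the quotient by `K` below corrects.
  let Z : C := ⨁ fun _ : Fin r => P
  let z : T.obj Z ⟶ n := ∑ i, T.map (biproduct.π (fun _ : Fin r => P) i) ≫ (b i : T.obj P ⟶ n)
  have hz : z ∈ Φ Z := Submodule.sum_mem _ fun i _ => hpre _ _ (b i).2
  have hιz (i : Fin r) : T.map (biproduct.ι (fun _ : Fin r => P) i) ≫ z = b i := by
    simp only [z, Preadditive.comp_sum, ← T.map_comp_assoc]
    rw [Finset.sum_eq_single i]
    · simp
    · intro j _ hj
      rw [biproduct.ι_π_ne _ hj.symm, T.map_zero, zero_comp]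
    · simp
  have hPz (f : T.obj P ⟶ n) (hf : f ∈ Φ P) : ∃ h : P ⟶ Z, T.map h ≫ z = f := by
    refine ⟨∑ i, b.repr ⟨f, hf⟩ i • biproduct.ι (fun _ : Fin r => P) i, ?_⟩
    rw [T.map_sum, Preadditive.sum_comp]
    simp only [T.map_smul, Linear.smul_comp, hιz]
    simpa only [Submodule.coe_sum, Submodule.coe_smul] using
      congrArg Subtype.val (b.sum_repr ⟨f, hf⟩)
  have hpow (a : ℕ) (f : T.obj (⨁ fun _ : Fin a => P) ⟶ n) (hf : f ∈ Φ _) :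
      ∃ h : (⨁ fun _ : Fin a => P) ⟶ Z, T.map h ≫ z = f := by
    choose g hg using fun j => hPz _ (hpre (biproduct.ι (fun _ : Fin a => P) j) f hf)
    refine ⟨biproduct.desc g, map_biproduct_hom_ext fun j => ?_⟩
    rw [← T.map_comp_assoc, biproduct.ι_desc, hg]
  have := IsFiniteLinear.noetherian (k := k) Z
  -- `K` is a maximal subobject of `Z` annihilated by `z`; it exists because `Z` is noetherian, and
  -- `⊥` shows that such subobjects occur.
  obtain ⟨K, hK, hmax⟩ := (wellFounded_gt (α := Subobject Z)).has_min
    {N | T.map N.arrow ≫ z = 0}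
    ⟨⊥, by
      change T.map _ ≫ z = 0
      rw [Subobject.bot_arrow, T.map_zero, zero_comp]⟩
  change T.map K.arrow ≫ z = 0 at hK
  -- Maximality makes `K` the largest such subobject: the image of `K ⊞ Q` in `Z` is again
  -- annihilated by `z`, since `T` preserves the epimorphism onto the image. Hence that image lies
  -- in `K`, and `h` dies in the quotient.
  have hker {Q : C} (h : Q ⟶ Z) (w : T.map h ≫ z = 0) : h ≫ cokernel.π K.arrow = 0 := by
    let q := biprod.desc K.arrow h
    have hq : T.map q ≫ z = 0 := by
      have : q = biprod.fst ≫ K.arrow + biprod.snd ≫ h := by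
        apply biprod.hom_ext' <;> simp [q]
      rw [this, T.map_add, T.map_comp, T.map_comp, Preadditive.add_comp, Category.assoc,
        Category.assoc, hK, w, comp_zero, comp_zero, add_zero]
    have hI : T.map (imageSubobject q).arrow ≫ z = 0 := by
      rw [← cancel_epi (T.map (factorThruImageSubobject q)), ← T.map_comp_assoc,
        imageSubobject_arrow_comp, hq, comp_zero]
    have hle : K ≤ imageSubobject q := by
      have h₁ : biprod.inl ≫ q = K.arrow := by simp [q]
      have h₂ := imageSubobject_comp_le biprod.inl q
      rwa [h₁, imageSubobject_mono, Subobject.mk_arrow] at h₂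
    have hge : imageSubobject q ≤ K := by
      by_contra h'
      exact hmax _ hI (lt_of_le_not_ge hle h')
    have h₁ : h = biprod.inr ≫ q := by simp [q]
    rw [h₁, ← imageSubobject_arrow_comp q, ← Subobject.ofLE_arrow hge]
    simp only [Category.assoc, cokernel.condition, comp_zero]
  -- Right exactness: `T` of the quotient `Z / K` is the cokernel of `T` of the inclusion of `K`, so
  -- `z` descends to `y`.
  let c := isColimitCoforkMapOfIsColimit' T (cokernel.condition K.arrow)
    (cokernelIsCokernel K.arrow)
  obtain ⟨y, hy⟩ : ∃ y : T.obj (cokernel K.arrow) ⟶ n, T.map (cokernel.π K.arrow) ≫ y = z :=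
    ⟨c.desc (CokernelCofork.ofπ z hK), c.fac _ WalkingParallelPair.one⟩
  have hyΦ : y ∈ Φ _ := hdesc (cokernel.π K.arrow) y (by rwa [hy])
  -- Pulling back `y` is injective. After covering `X` by a power of `P`, a map to `Z / K` lifts to
  -- `Z` by projectivity, and a lift annihilated by `z` becomes zero in the quotient by `hker`.
  have hinj {X : C} (f : X ⟶ cokernel K.arrow) (w : T.map f ≫ y = 0) : f = 0 := by
    obtain ⟨a, p, hp⟩ := hgen X
    have := hpro a
    let g := Projective.factorThru (p ≫ f) (cokernel.π K.arrow)
    have hg : g ≫ cokernel.π K.arrow = p ≫ f := Projective.factorThru_comp _ _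
    rw [← cancel_epi p, comp_zero, ← hg]
    apply hker
    rw [← hy, ← T.map_comp_assoc, hg, T.map_comp_assoc, w, comp_zero]
  refine ⟨_, y, hyΦ, fun X f hf => ?_⟩
  obtain ⟨a, p, hp⟩ := hgen X
  obtain ⟨h, hh⟩ := hpow a (T.map p ≫ f) (hpre p f hf)
  have hh' : T.map (h ≫ cokernel.π K.arrow) ≫ y = T.map p ≫ f := by
    rw [T.map_comp_assoc, hy, hh]
  -- The solution over the cover of `X` kills `kernel p`: there it pulls `y` back to the restriction
  -- of `T.map p ≫ f`, which is zero, so `hinj` applies. Hence the solution descends to `X`.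
  have hk : kernel.ι p ≫ h ≫ cokernel.π K.arrow = 0 := by
    apply hinj
    rw [T.map_comp_assoc, hh', ← T.map_comp_assoc, kernel.condition, T.map_zero, zero_comp]
  obtain ⟨g, hg⟩ : ∃ g, p ≫ g = h ≫ cokernel.π K.arrow :=
    ⟨Abelian.epiDesc p _ hk, Abelian.comp_epiDesc p _ hk⟩
  have hgf : T.map g ≫ y = f := by
    rw [← cancel_epi (T.map p), ← T.map_comp_assoc, hg, hh']
  refine ⟨g, hgf, fun g' hg' => ?_⟩
  rw [← sub_eq_zero]
  apply hinj
  rw [T.map_sub, Preadditive.sub_comp, hg', hgf, sub_self]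

end Representability

/-! ### Existence of internal Homs and relative ends -/

section Existence

open MonoidalLeftAction VEnd

attribute [local instance] Abelian.hasFiniteBiproducts

variable (k : Type w) [Field k]
  {C : Type u₂} [Category.{v₂} C] [Abelian C] [Linear k C] [MonoidalCategory C]
  {M : Type u₃} [Category.{v₃} M] [Abelian M] [Linear k M]
  [MonoidalLeftAction C M] [IsModuleCategory k C M]

include k in
/-- Internal Homs exist in a module category. -/
theorem nonempty_internalHom [IsFiniteLinear k C] [IsFiniteLinear k M] (m n : M) :
    Nonempty (InternalHom C m n) := by
  have : (actionRight C m).Additive := IsModuleCategory.additive_right (k := k) m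
  have : (actionRight C m).Linear k := IsModuleCategory.linear_right m
  have : PreservesFiniteColimits (actionRight C m) :=
    IsModuleCategory.preservesFiniteColimits_right (k := k) m
  -- With the full spaces `⊤` as the family of subspaces, closure under precomposition and descent
  -- holds trivially.
  obtain ⟨Y, y, -, hy⟩ := exists_representing_of_descent (k := k) (actionRight C m) n
    (fun X => IsFiniteLinear.finite_hom _ _) (fun _ => ⊤) (fun _ _ _ => trivial)
    (fun _ _ _ _ => trivial)
  exact ⟨
    { obj := Y
      homEquiv := fun X => Equiv.ofBijective (fun h => h ⊵ₗ m ≫ y)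
        ⟨fun g h e => (hy X (h ⊵ₗ m ≫ y) trivial).unique e rfl,
          fun f => (hy X f trivial).exists⟩
      homEquiv_naturality := fun h f => by
        change (h ≫ f) ⊵ₗ m ≫ y = h ⊵ₗ m ≫ f ⊵ₗ m ≫ y
        exact (congrArg (· ≫ y) (comp_actionHomLeft h f m)).trans (Category.assoc _ _ _) }⟩

variable {k}
  {V : Type u₁} [Category.{v₁} V] [MonoidalCategory V]
  {G : V ⥤ Center C} [G.Monoidal]

/-! ### Module transformations out of `ρ(X)` -/

section

variable {X : C} {F : VEnd k G M}

/-- The components `X ▷ m ⟶ F(m)` of a module transformation `ρ(X) ⟶ F`. -/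
def rhoApp (θ : (rho k G M).obj X ⟶ F) (m : M) : X ⊙ₗ m ⟶ F.functor.obj m := θ.app m

lemma rhoApp_nat (θ : (rho k G M).obj X ⟶ F) {m n : M} (f : m ⟶ n) :
    X ⊴ₗ f ≫ rhoApp θ n = rhoApp θ m ≫ F.functor.map f := θ.naturality f

lemma rhoApp_comm (θ : (rho k G M).obj X ⟶ F) (U : V) (m : M) :
    rhoApp θ (vObj G U m) ≫ (F.d U m).hom =
      (vSwap G X U m).hom ≫ (und G).obj U ⊴ₗ rhoApp θ m := θ.comm U m

/-- A module transformation `ρ(X) ⟶ F` from its components. -/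
def rhoMk (g : ∀ m : M, X ⊙ₗ m ⟶ F.functor.obj m)
    (nat : ∀ {m n : M} (f : m ⟶ n), X ⊴ₗ f ≫ g n = g m ≫ F.functor.map f)
    (comm : ∀ (U : V) (m : M), g (vObj G U m) ≫ (F.d U m).hom =
      (vSwap G X U m).hom ≫ (und G).obj U ⊴ₗ g m) : (rho k G M).obj X ⟶ F where
  app := g
  naturality := nat
  comm := comm

/-- A module transformation `ρ(X) ⟶ F` is determined by its component at a generator. -/
lemma rho_hom_ext {Q : M} (hQ : ∀ m : M, ∃ (a : ℕ) (p : (⨁ fun _ : Fin a => Q) ⟶ m), Epi p)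
    {θ θ' : (rho k G M).obj X ⟶ F} (h : rhoApp θ Q = rhoApp θ' Q) : θ = θ' := by
  have : (actionLeft M X).Additive := IsModuleCategory.additive_left (k := k) X
  have : PreservesFiniteColimits (actionLeft M X) :=
    IsModuleCategory.preservesFiniteColimits_left (k := k) X
  ext m
  -- Since `X ▷ -` is additive and right exact, `X ▷ m` is a quotient of `X ▷ Q ^ a` and a map out
  -- of it is determined on the copies of `X ▷ Q`. There naturality expresses it through the
  -- component at `Q`; exactness of `F` plays no role.
  obtain ⟨a, p, hp⟩ := hQ m
  have hp' : Epi ((actionLeft M X).map p) := inferInstance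
  refine (cancel_epi ((actionLeft M X).map p)).1
    (map_biproduct_hom_ext (T := actionLeft M X) fun j => ?_)
  change X ⊴ₗ _ ≫ X ⊴ₗ p ≫ rhoApp θ m = X ⊴ₗ _ ≫ X ⊴ₗ p ≫ rhoApp θ' m
  rw [← actionHomRight_comp_assoc, rhoApp_nat, ← actionHomRight_comp_assoc, rhoApp_nat, h]

variable (X F) in
/-- The zero module transformation `ρ(X) ⟶ F`. -/
def rhoZero : (rho k G M).obj X ⟶ F :=
  rhoMk (fun m => 0) (fun f => by simp) fun U m => by
    have : (actionLeft M ((und G).obj U)).Additive := IsModuleCategory.additive_left (k := k) _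
    have h : (und G).obj U ⊴ₗ (0 : X ⊙ₗ m ⟶ F.functor.obj m) = 0 :=
      (actionLeft M ((und G).obj U)).map_zero _ _
    rw [h, zero_comp, comp_zero]

end

variable (k G) in
/-- The components at `Q` of the module transformations `ρ(X) ⟶ F`. -/
def rhoHomSubmodule (F : VEnd k G M) (Q : M) (X : C) :
    Submodule k ((actionRight C Q).obj X ⟶ F.functor.obj Q) where
  carrier := {f | ∃ θ : (rho k G M).obj X ⟶ F, rhoApp θ Q = f}
  zero_mem' := ⟨rhoZero X F, rfl⟩
  add_mem' := by
    rintro _ _ ⟨θ, rfl⟩ ⟨θ', rfl⟩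
    refine ⟨rhoMk (fun m => rhoApp θ m + rhoApp θ' m) (fun f => ?_) (fun U m => ?_), rfl⟩
    · rw [Preadditive.comp_add, Preadditive.add_comp, rhoApp_nat, rhoApp_nat]
    · have : (actionLeft M ((und G).obj U)).Additive := IsModuleCategory.additive_left (k := k) _
      have h : (und G).obj U ⊴ₗ (rhoApp θ m + rhoApp θ' m) =
          (und G).obj U ⊴ₗ rhoApp θ m + (und G).obj U ⊴ₗ rhoApp θ' m :=
        (actionLeft M ((und G).obj U)).map_add
      rw [Preadditive.add_comp, rhoApp_comm, rhoApp_comm, h, Preadditive.comp_add]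
  smul_mem' := by
    rintro r _ ⟨θ, rfl⟩
    refine ⟨rhoMk (fun m => r • rhoApp θ m) (fun f => ?_) (fun U m => ?_), rfl⟩
    · rw [Linear.comp_smul, Linear.smul_comp, rhoApp_nat]
    · have : (actionLeft M ((und G).obj U)).Linear k := IsModuleCategory.linear_left _
      have h : (und G).obj U ⊴ₗ (r • rhoApp θ m) = r • (und G).obj U ⊴ₗ rhoApp θ m :=
        (actionLeft M ((und G).obj U)).map_smul r _
      rw [Linear.smul_comp, rhoApp_comm, h, Linear.comp_smul]

/-- A module transformation `ρ(X) ⟶ F` descends along an epimorphism `X ⟶ Y` if its component at a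
generator does. -/
lemma exists_rho_hom_desc {Q : M}
    (hQ : ∀ m : M, ∃ (a : ℕ) (p : (⨁ fun _ : Fin a => Q) ⟶ m), Epi p)
    {F : VEnd k G M} {X Y : C} (p : X ⟶ Y) [Epi p] (θ : (rho k G M).obj X ⟶ F)
    (f : Y ⊙ₗ Q ⟶ F.functor.obj Q) (hf : rhoApp θ Q = p ⊵ₗ Q ≫ f) :
    ∃ θ' : (rho k G M).obj Y ⟶ F, rhoApp θ' Q = f := by
  have hadd (m : M) : (actionRight C m).Additive := IsModuleCategory.additive_right (k := k) m
  have hcol (m : M) : PreservesFiniteColimits (actionRight C m) :=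
    IsModuleCategory.preservesFiniteColimits_right (k := k) m
  have hepi (m : M) : Epi (p ⊵ₗ m) := inferInstanceAs (Epi ((actionRight C m).map p))
  have hzero (m : M) : kernel.ι p ⊵ₗ m ≫ p ⊵ₗ m = 0 := by
    rw [← comp_actionHomLeft, kernel.condition]
    exact (actionRight C m).map_zero _ _
  -- The restriction of `θ` to `ρ(kernel p)` is itself a module transformation. Its component at `Q`
  -- vanishes because `rhoApp θ Q` factors through `p`, so by `rho_hom_ext` all its components
  -- vanish.
  have hker (m : M) : kernel.ι p ⊵ₗ m ≫ rhoApp θ m = 0 := by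
    have h : (rho k G M).map (kernel.ι p) ≫ θ = rhoZero (kernel p) F := by
      apply rho_hom_ext hQ
      change kernel.ι p ⊵ₗ Q ≫ rhoApp θ Q = 0
      rw [hf, reassoc_of% hzero Q, zero_comp]
    exact congrArg (fun τ => Hom.app τ m) h
  -- Since `- ▷ m` is right exact, `p ▷ m` is the cokernel of `kernel.ι p ▷ m`, and each component
  -- factors through it.
  have hdesc (m : M) : ∃ g : Y ⊙ₗ m ⟶ F.functor.obj m, p ⊵ₗ m ≫ g = rhoApp θ m := by
    let c := isColimitCoforkMapOfIsColimit' (actionRight C m) (kernel.condition p)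
      (Abelian.epiIsCokernelOfKernel _ (limit.isLimit _))
    exact ⟨c.desc (CokernelCofork.ofπ (rhoApp θ m) (hker m)), c.fac _ WalkingParallelPair.one⟩
  choose g hg using hdesc
  -- All three conditions on the descended family are checked after precomposition with the
  -- epimorphisms `p ▷ m`, where they reduce to the corresponding facts about `θ`.
  refine ⟨rhoMk g (fun {m n} e => ?_) (fun U m => ?_), ?_⟩
  · rw [← cancel_epi (p ⊵ₗ m), reassoc_of% hg m, ← rhoApp_nat, ← hg n, action_exchange_assoc]
  · rw [← cancel_epi (p ⊵ₗ vObj G U m), reassoc_of% hg (vObj G U m), rhoApp_comm, ← hg m,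
      actionHomRight_comp, reassoc_of% vSwap_nat_left G p U m]
  · rw [← cancel_epi (p ⊵ₗ Q), ← hf, ← hg]
    rfl

/-! ### Representing module transformations by relative ends -/

variable [RightRigidCategory V] [IsFiniteLinear k C] [IsFiniteLinear k M]

/-- Relative ends `∮ (Hom(m, F(m)), β)` exist. -/
theorem nonempty_relEnd (H : ∀ m n : M, InternalHom C m n) (F : VEnd k G M) :
    Nonempty (RelEnd G (uhom H F.functor) (beta H F)) := by
  obtain ⟨Q, -, hQ⟩ := IsFiniteLinear.exists_generator k M
  have : (actionRight C Q).Additive := IsModuleCategory.additive_right (k := k) Q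
  have : (actionRight C Q).Linear k := IsModuleCategory.linear_right Q
  have : PreservesFiniteColimits (actionRight C Q) :=
    IsModuleCategory.preservesFiniteColimits_right (k := k) Q
  -- The representing element `y` lies in the subspace, so it is the component at `Q` of a
  -- transformation `θ : ρ(Y) ⟶ F`; the cone attached to `θ` is the universal one.
  obtain ⟨Y, y, ⟨θ, rfl⟩, hy⟩ := exists_representing_of_descent (k := k) (actionRight C Q)
    (F.functor.obj Q) (fun X => IsFiniteLinear.finite_hom _ _) (rhoHomSubmodule k G F Q)
    (by
      rintro X Y h _ ⟨θ, rfl⟩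
      exact ⟨(rho k G M).map h ≫ θ, rfl⟩)
    (by
      rintro X Y p hp f ⟨θ, hθ⟩
      exact exists_rho_hom_desc hQ p θ f hθ)
  refine ⟨{ toRelEndCone := coneOfHom H θ, existsUnique_lift := fun c => ?_ }⟩
  -- A factorization of cones is an equation for every `m`. Under the internal Hom bijections these
  -- equations compare two module transformations out of `ρ(c.pt)`, so the single equation at `Q`
  -- suffices, and that is the one governed by the universal property of `y`.
  have hiff (h : c.pt ⟶ Y) : (∀ m, c.π m = h ≫ (coneOfHom H θ).π m) ↔
      h ⊵ₗ Q ≫ rhoApp θ Q = rhoApp (homOfCone H c) Q := by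
    have hcomp (m : M) : c.π m = h ≫ (coneOfHom H θ).π m ↔
        rhoApp (homOfCone H c) m = h ⊵ₗ m ≫ rhoApp θ m := by
      have e : h ≫ (H m (F.functor.obj m)).psi (rhoApp θ m) =
          (H m (F.functor.obj m)).psi (h ⊵ₗ m ≫ rhoApp θ m) := InternalHom.comp_psi _ _ _
      change c.π m = h ≫ (H m (F.functor.obj m)).psi (rhoApp θ m) ↔
        (H m (F.functor.obj m)).homEquiv _ (c.π m) = h ⊵ₗ m ≫ rhoApp θ m
      rw [← Equiv.eq_symm_apply]
      exact Eq.congr_right e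
    refine ⟨fun w => ((hcomp Q).1 (w Q)).symm, fun w m => (hcomp m).2 ?_⟩
    have e : (rho k G M).map h ≫ θ = homOfCone H c := rho_hom_ext hQ w
    rw [← e]
    rfl
  obtain ⟨h, hh, huniq⟩ := hy c.pt (rhoApp (homOfCone H c) Q) ⟨homOfCone H c, rfl⟩
  exact ⟨h, (hiff h).2 hh, fun h' w => huniq h' ((hiff h').1 w)⟩

end Existence

/-! ### Objects of `C(V, M)` centralize `G(V)` -/

section Adjoint

open MonoidalLeftAction Functor.OplaxLeftLinear Functor.OplaxRightLinear

variable {C : Type u₁} [Category.{v₁} C] [MonoidalCategory C]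
  {D : Type u₂} [Category.{v₂} D] {D' : Type u₃} [Category.{v₃} D']
  {L : D ⥤ D'} {R : D' ⥤ D} (adj : L ⊣ R)
  [MonoidalLeftAction C D] [MonoidalLeftAction C D'] [L.LeftLinear C]
  [MonoidalRightAction C D] [MonoidalRightAction C D'] [L.RightLinear C]

/-- The two sides of `h` are the transposes under `L ⊣ R` of the two sides of the conclusion. This
reduces the identification of the half-braiding on `R(n)` induced by `σ` with a candidate `s` to an
equation in `D'` that involves only the counit and the module structures of `L`. -/
lemma adjμᵣ_comp_eq_comp_adjμₗ {X : C} {n : D'} (σ : n ⊙ᵣ X ⟶ X ⊙ₗ n)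
    (s : R.obj n ⊙ᵣ X ⟶ X ⊙ₗ R.obj n)
    (h : δᵣ L (R.obj n) X ≫ adj.counit.app n ⊵ᵣ X ≫ σ =
      L.map s ≫ δₗ L X (R.obj n) ≫ X ⊴ₗ adj.counit.app n) :
    adjμᵣ adj n X ≫ R.map σ = s ≫ adjμₗ adj X n := by
  apply adj_hom_ext adj
  simp [adjμₗ_counit, adjμᵣ_counit_assoc, h]

end Adjoint

section Centralizing

open MonoidalLeftAction VEnd Functor.LaxLeftLinear Functor.OplaxLeftLinear
  Functor.LaxRightLinear Functor.OplaxRightLinear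

/-- An object of the center centralizes `G(V)` if its half-braiding with each `G(U)` is inverse to
the half-braiding of `G(U)`. -/
lemma isCentralizing_of_hb {V : Type u₁} [Category.{v₁} V] {C : Type u₂} [Category.{v₂} C]
    [MonoidalCategory C] {G : V ⥤ Center C} {A : Center C}
    (h : ∀ U : V, (A.2.β ((und G).obj U)).hom = (hb G U A.1).inv) : isCentralizing G A := by
  intro U
  ext
  change (A.2.β ((und G).obj U)).hom ≫ (hb G U A.1).hom = 𝟙 _
  rw [h, Iso.inv_hom_id]

variable {k : Type w} [Field k]
  {V : Type u₁} [Category.{v₁} V] [MonoidalCategory V]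
  {C : Type u₂} [Category.{v₂} C] [MonoidalCategory C]
  {G : V ⥤ Center C} [G.Monoidal]
  {M : Type u₃} [Category.{v₃} M] [Preadditive M] [Linear k M] [MonoidalLeftAction C M]
  [Preadditive C] [Linear k C] [IsModuleCategory k C M]

variable [RightRigidCategory V] [RigidCategory C] (H : ∀ m n : M, InternalHom C m n)
  (E : ∀ F : VEnd k G M, RelEnd G (uhom H F.functor) (beta H F))

/-- The half-braiding of `Z_C(ρ̄)(F, c, d)` with `G(U)` is `σ⁻¹` if `c` and `d` agree on `U`. -/
lemma mapHb_rhoBar {A : RelCenter C (VEnd k G M)} (hA : isRestricted k G M A) (U : V) :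
    (RelCenter.mapHb (rhoBar H E) A ((und G).obj U)).hom =
      (hb G U ((rhoBar H E).obj A.obj)).inv := by
  -- The asserted equality with the inverse of the left module structure of `ρ̄` moved to the other
  -- side; in this form it can be transposed, with `σ⁻¹` as the candidate.
  have key : adjμᵣ (rhoAdj H E) A.obj ((und G).obj U) ≫
      (rhoBar H E).map (A.hb ((und G).obj U)).hom =
        (hb G U ((rhoBar H E).obj A.obj)).inv ≫ adjμₗ (rhoAdj H E) ((und G).obj U) A.obj := by
    refine adjμᵣ_comp_eq_comp_adjμₗ (rhoAdj H E) _ _ (VEnd.hom_ext fun m => ?_)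
    -- The heart of the argument: the counit is a morphism of `V`-module functors. The condition
    -- `hA` then turns the `d` in this equation into `c`.
    have h := ((rhoAdj H E).counit.app A.obj).comm U m
    replace h := (congrArg (_ ≫ ·) (hA U m)).trans h
    change (αₗ ((rhoBar H E).obj A.obj) ((und G).obj U) m).hom ≫
        Hom.app ((rhoAdj H E).counit.app A.obj) (vObj G U m) ≫
          (A.hb ((und G).obj U)).hom.app m =
      (hb G U ((rhoBar H E).obj A.obj)).inv ⊵ₗ m ≫
        (αₗ ((und G).obj U) ((rhoBar H E).obj A.obj) m).hom ≫
          (und G).obj U ⊴ₗ Hom.app ((rhoAdj H E).counit.app A.obj) m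
    refine (congrArg ((αₗ ((rhoBar H E).obj A.obj) ((und G).obj U) m).hom ≫ ·) h).trans ?_
    -- The `V`-module structure of `ρ(ρ̄(F))` unfolds to `σ⁻¹` conjugated by action associators. The
    -- first of these cancels against the right module structure of `ρ`, and the last is its left
    -- module structure.
    change (αₗ ((rhoBar H E).obj A.obj) ((und G).obj U) m).hom ≫
      ((αₗ ((rhoBar H E).obj A.obj) ((und G).obj U) m).inv ≫
        (hb G U ((rhoBar H E).obj A.obj)).inv ⊵ₗ m ≫
          (αₗ ((und G).obj U) ((rhoBar H E).obj A.obj) m).hom) ≫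
            (und G).obj U ⊴ₗ Hom.app ((rhoAdj H E).counit.app A.obj) m = _
    simp only [Category.assoc, Iso.hom_inv_id_assoc]
  change μᵣ (rhoBar H E) A.obj _ ≫ (rhoBar H E).map _ ≫ δₗ (rhoBar H E) _ A.obj = _
  have h := congrArg (· ≫ δₗ (rhoBar H E) ((und G).obj U) A.obj) key
  simp only [Category.assoc] at h
  refine h.trans ?_
  -- Rigidity of `C` makes the lax structure `adjμₗ` invertible, with inverse the `δₗ` occurring in
  -- the half-braiding, so it can be removed from `key`.
  have h' : adjμₗ (rhoAdj H E) ((und G).obj U) A.obj ≫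
      δₗ (rhoBar H E) ((und G).obj U) A.obj = 𝟙 _ :=
    Functor.LeftLinear.μₗ_comp_δₗ (rhoBar H E) ((und G).obj U) A.obj
  refine (congrArg (_ ≫ ·) h').trans ?_
  exact Category.comp_id _

/-- The functor `Z_C(ρ̄)` sends objects of `C(V, M)` to objects centralizing `G(V)`. -/
theorem isCentralizing_centerRhoBar {A : RelCenter C (VEnd k G M)} (hA : isRestricted k G M A) :
    isCentralizing G ((centerRhoBar H E).obj A) :=
  isCentralizing_of_hb fun U => mapHb_rhoBar H E hA U

end Centralizing

/-! ### The equivalence between the dual category and `C(V, M)` -/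

section DualEquivalence

open MonoidalLeftAction VEnd Functor.LaxLeftLinear Functor.OplaxLeftLinear

variable {k : Type w} [Field k]
  {V : Type u₁} [Category.{v₁} V] [MonoidalCategory V]
  {C : Type u₂} [Category.{v₂} C] [MonoidalCategory C]
  {G : V ⥤ Center C} [G.Monoidal]
  {M : Type u₃} [Category.{v₃} M] [Preadditive M] [Linear k M] [MonoidalLeftAction C M]
  [Preadditive C] [Linear k C] [IsModuleCategory k C M]

/-! ### From objects of `C(V, M)` to `C`-module functors -/

namespace RelCenter

variable (A : RelCenter C (VEnd k G M))

/-- The component `c_{X,m} : F(X ▷ m) ≅ X ▷ F(m)` of the half-braiding of `(F, c, d)`. -/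
def hbApp (X : C) (m : M) : A.obj.functor.obj (X ⊙ₗ m) ≅ X ⊙ₗ A.obj.functor.obj m where
  hom := (A.hb X).hom.app m
  inv := (A.hb X).inv.app m
  hom_inv_id := congrArg (fun τ => VEnd.Hom.app τ m) (A.hb X).hom_inv_id
  inv_hom_id := congrArg (fun τ => VEnd.Hom.app τ m) (A.hb X).inv_hom_id

lemma hbApp_nat (X : C) {m n : M} (f : m ⟶ n) :
    A.obj.functor.map (X ⊴ₗ f) ≫ (A.hbApp X n).hom =
      (A.hbApp X m).hom ≫ X ⊴ₗ A.obj.functor.map f :=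
  (A.hb X).hom.naturality f

lemma hbApp_nat_left {X Y : C} (f : X ⟶ Y) (m : M) :
    A.obj.functor.map (f ⊵ₗ m) ≫ (A.hbApp Y m).hom =
      (A.hbApp X m).hom ≫ f ⊵ₗ A.obj.functor.obj m :=
  congrArg (fun τ => VEnd.Hom.app τ m) (A.naturality f)

lemma hbApp_tensor (X Y : C) (m : M) :
    (A.hbApp (X ⊗ Y) m).hom ≫ (αₗ X Y (A.obj.functor.obj m)).hom =
      A.obj.functor.map (αₗ X Y m).hom ≫ (A.hbApp X (Y ⊙ₗ m)).hom ≫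
        X ⊴ₗ (A.hbApp Y m).hom := by
  refine (congrArg (fun τ => VEnd.Hom.app τ m) (A.monoidal X Y)).trans ?_
  change A.obj.functor.map (αₗ X Y m).hom ≫ (A.hbApp X (Y ⊙ₗ m)).hom ≫ 𝟙 _ ≫
    X ⊴ₗ (A.hbApp Y m).hom = _
  rw [Category.id_comp]

variable {A} (hA : isRestricted k G M A)

-- A half-braiding here carries no unit axiom, so it is taken from `d`. The structures `c` and `d`
-- agree at `G(1)`, where `d` satisfies its unit axiom, and naturality of `c` along the isomorphism
-- `G(1) ≅ 1` carries this to the unit of `C`.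
include hA in
lemma hbApp_unit (m : M) :
    (A.hbApp (𝟙_ C) m).hom ≫ (λₗ (A.obj.functor.obj m)).hom =
      A.obj.functor.map (λₗ m).hom := by
  have h₁ := A.hbApp_nat_left (Functor.OplaxMonoidal.η (und G)) m
  have h₂ := A.obj.d_unit m
  change (A.obj.d (𝟙_ V) m).hom ≫ _ ⊵ₗ _ ≫ (λₗ _).hom =
    A.obj.functor.map (_ ⊵ₗ _ ≫ (λₗ _).hom) at h₂
  have h₃ : (A.hbApp ((und G).obj (𝟙_ V)) m).hom = (A.obj.d (𝟙_ V) m).hom := hA _ m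
  rw [← h₃, ← reassoc_of% h₁, Functor.map_comp] at h₂
  exact (cancel_epi (A.obj.functor.map (Functor.OplaxMonoidal.η (und G) ⊵ₗ m))).1 h₂

/-- The module functor `(F, c)` underlying an object `(F, c, d)` of `C(V, M)`. -/
def toDualCat : DualCat k C M where
  functor := A.obj.functor
  additive := A.obj.additive
  linear := A.obj.linear
  leftLinear :=
    { μₗ := fun X m => (A.hbApp X m).inv
      δₗ := fun X m => (A.hbApp X m).hom
      μₗ_comp_δₗ := fun X m => (A.hbApp X m).inv_hom_id
      δₗ_comp_μₗ := fun X m => (A.hbApp X m).hom_inv_id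
      δₗ_naturality_left := fun f m => A.hbApp_nat_left f m
      δₗ_naturality_right := fun X _ _ f => A.hbApp_nat X f
      δₗ_associativity := fun X Y m => A.hbApp_tensor X Y m
      δₗ_unitality_inv := fun m => by
        rw [← cancel_epi (A.obj.functor.map (actionUnitIso (C := C) m).hom),
          ← Functor.map_comp_assoc, Iso.hom_inv_id, CategoryTheory.Functor.map_id, Category.id_comp, ← hbApp_unit hA, Category.assoc,
          Iso.hom_inv_id, Category.comp_id]
      μₗ_naturality_left := fun {X Y} f m => by
        rw [Iso.comp_inv_eq, Category.assoc, A.hbApp_nat_left, Iso.inv_hom_id_assoc]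
      μₗ_naturality_right := fun X _ _ f => by
        rw [Iso.comp_inv_eq, Category.assoc, A.hbApp_nat, Iso.inv_hom_id_assoc]
      μₗ_associativity := fun X Y m => by
        rw [Iso.inv_comp_eq, reassoc_of% A.hbApp_tensor, ← actionHomRight_comp_assoc]
        simp
      μₗ_unitality := fun m => by
        rw [← hbApp_unit hA, Iso.inv_hom_id_assoc] }

end RelCenter

/-! ### Full faithfulness and essential surjectivity -/

namespace DualCat

instance : (toCentralEnd k G M).Faithful where
  map_injective {F F'} _ _ h := DualCat.Hom.ext
    (congrArg (fun τ : (toCentralEnd k G M).obj F ⟶ (toCentralEnd k G M).obj F' =>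
      VEnd.Hom.app τ.hom.hom) h)

/-- Compatibility with the half-braidings, read at each component, is compatibility with the
`C`-module structures, so the given components already form a morphism of module functors. -/
instance : (toCentralEnd k G M).Full where
  map_surjective f :=
    ⟨{ app := f.hom.hom.app
       naturality := f.hom.hom.naturality
       comm := fun X m => congrArg (fun τ => VEnd.Hom.app τ m) (f.hom.comm X) }, rfl⟩

/-- Forgetting `d` and restricting `c` to `V` again returns the same functor and half-braiding, with
`c|_V` in place of `d`. These agree by the defining condition of `C(V, M)`, so the identity
components form an isomorphism. -/
instance : (toCentralEnd k G M).EssSurj where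
  mem_essImage B := by
    let A := B.obj
    let F : DualCat k C M := RelCenter.toDualCat B.property
    have hd (U : V) (m : M) : ((F.restrict G).d U m).hom = (A.obj.d U m).hom := B.property U m
    refine ⟨F, ⟨(isRestricted k G M).isoMk
      { hom :=
          { hom :=
              { app := fun m => 𝟙 _
                naturality := fun f => (Category.comp_id _).trans (Category.id_comp _).symm
                comm := fun U m => ?_ }
            comm := fun X => VEnd.hom_ext fun m => ?_ }
        inv :=
          { hom :=
              { app := fun m => 𝟙 _
                naturality := fun f => (Category.comp_id _).trans (Category.id_comp _).symm
                comm := fun U m => ?_ }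
            comm := fun X => VEnd.hom_ext fun m => ?_ }
        hom_inv_id := RelCenter.hom_ext (VEnd.hom_ext fun m => Category.comp_id _)
        inv_hom_id := RelCenter.hom_ext (VEnd.hom_ext fun m => Category.comp_id _) }⟩⟩
    -- Compatibility with the `V`-structures is what needs `c|_V = d`, once in each direction; the
    -- half-braidings on both sides have the same components by construction.
    · refine (Category.id_comp _).trans ((hd U m).symm.trans ?_)
      exact ((congrArg (_ ≫ ·) (actionHomRight_id _ _)).trans (Category.comp_id _)).symm
    · refine (Category.id_comp _).trans ?_
      exact ((congrArg (_ ≫ ·) (actionHomRight_id _ _)).trans (Category.comp_id _)).symm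
    · refine (Category.id_comp _).trans ((hd U m).trans ?_)
      exact ((congrArg (_ ≫ ·) (actionHomRight_id _ _)).trans (Category.comp_id _)).symm
    · refine (Category.id_comp _).trans ?_
      exact ((congrArg (_ ≫ ·) (actionHomRight_id _ _)).trans (Category.comp_id _)).symm

instance : (toCentralEnd k G M).IsEquivalence where

end DualCat

end DualEquivalence

end CentralHopf

theorem mainTheorem2 {k : Type w} [Field k] [IsAlgClosed k]
    {V : Type u₁} [Category.{v₁} V] [Abelian V] [Linear k V] [MonoidalCategory V]
    [RigidCategory V] [IsFiniteTensor k V] [BraidedCategory V]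
    {C : Type u₂} [Category.{v₂} C] [Abelian C] [Linear k C] [MonoidalCategory C]
    [RigidCategory C] [IsFiniteTensor k C]
    (G : V ⥤ Center C) [G.Braided] [G.Faithful] [PreservesFiniteColimits G]
    [(und G).Additive] [(und G).Linear k]
    {M : Type u₃} [Category.{v₃} M] [Abelian M] [Linear k M] [IsFiniteLinear k M]
    [MonoidalLeftAction C M] [IsModuleCategory k C M] :
    (∀ m n : M, Nonempty (InternalHom C m n)) ∧
    ∀ H : ∀ m n : M, InternalHom C m n,
      (∀ F : VEnd k G M, Nonempty (RelEnd G (uhom H F.functor) (beta H F))) ∧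
      ∀ E : ∀ F : VEnd k G M, RelEnd G (uhom H F.functor) (beta H F),
        (∀ A : RelCenter C (VEnd k G M), isRestricted k G M A →
          isCentralizing G ((centerRhoBar H E).obj A)) ∧
        (∃ Φ : CentralEnd k G M ⥤ CentralizerCat G,
          Φ ⋙ (isCentralizing G).ι = (isRestricted k G M).ι ⋙ centerRhoBar H E) ∧
        (DualCat.toCentralEnd k G M).IsEquivalence ∧
        (∃ Ψ : DualCat k C M ⥤ CentralizerCat G,
          Ψ ⋙ (isCentralizing G).ι =
            DualCat.toCentralEnd k G M ⋙ (isRestricted k G M).ι ⋙ centerRhoBar H E) := by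
  refine ⟨fun m n => nonempty_internalHom k m n, fun H =>
    ⟨fun F => nonempty_relEnd H F, fun E => ?_⟩⟩
  -- Since `Z^V(C)` is full, a functor to `Z(C)` factors through it as soon as its objects do. The
  -- lift changes nothing else, so the required equalities of functors hold by `rfl`, both for `Φ`
  -- and for its composite with `DualCat.toCentralEnd`.
  let Φ : CentralEnd k G M ⥤ CentralizerCat G :=
    (isCentralizing G).lift ((isRestricted k G M).ι ⋙ centerRhoBar H E)
      fun A => isCentralizing_centerRhoBar H E A.property
  exact ⟨fun A hA => isCentralizing_centerRhoBar H E hA, ⟨Φ, rfl⟩, inferInstance,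
    ⟨DualCat.toCentralEnd k G M ⋙ Φ, rfl⟩⟩
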